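/- Let $n\ge 1$ and let $W=\mathbb{R}^{1,n+2}$ be Minkowski space. Let $\mathbb{S}^{n+1}=\mathbb{P}W_0$ be the conformal sphere, i.e. the set of isotropic lines of $W$, on which $G=\mathrm{SO}(1,n+2)$ (all linear isometries of $W$ of determinant $1$) acts, and let $J^2=J^2(n,\mathbb{S}^{n+1})$ be the space of $2$-jets $[S]^2_a$ of embedded smooth hypersurfaces $S\subset\mathbb{S}^{n+1}$ at points $a\in S$, with the action $g\cdot[S]^2_a=[g(S)]^2_{g(a)}$. A basis $p,e_0,\dots,e_n,q$ of $W$ with $p,q$ isotropic, $p\cdot q=1$, and $e_0,\dots,e_n$ orthonormal and orthogonal to $p$ and $q$ defines standard coordinates $(u,x)=(u,x^1,\dots,x^n)$ of the point $\left[\,p+u e_0+\sum_i x^i e_i-\tfrac12(u^2+\|x\|^2)q\,\right]$ of $\mathbb{S}^{n+1}$; in these coordinates the Euclidean metric $du^2+\sum_i(dx^i)^2$ represents the conformal class. For a graph $u=f(x)$ put $g_{ij}=\delta_{ij}+u_iu_j$ and $\beta_{ij}=u_{ij}\big/\sqrt{1+\sum_k u_k^2}$, where $u_i=\partial_i f$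 and $u_{ij}=\partial_i\partial_j f$. Let $A=g^{-1}\beta$ be the shape operator and let $A_\circ=A-\tfrac1n\operatorname{tr}(A)\,\mathrm{Id}$ be the conformal shape operator. Let $\mathcal{E}\subset J^2$ be a second-order PDE for hypersurfaces of $\mathbb{S}^{n+1}$ which is $G$-invariant, i.e. $g\cdot\mathcal{E}=\mathcal{E}$ for all $g\in G$, and polynomial in the second-order derivatives: in a system of standard coordinates it is the zero set of a function $\Phi(u,x,u_i;u_{ij})$ that is polynomial in the $u_{ij}$, with coefficients depending on $(u,x,u_i)$. Then there is a polynomial $F$ in variables $\tau_2,\dots,\tau_n$, weighted-homogeneous with respect to $\deg\tau_h=h$, such that $\mathcal{E}$ is the PDE $$F\big(\operatorname{tr}(A_\circ^2),\dots,\operatorname{tr}(A_\circ^n)\big)=0,$$ i.e. for every hypersurface $S$, every $a\in S$, and all standard coordinates in which $S$ is a graph near $a$, one has $[S]^2_a\in\mathcal{E}$ if and only if this equation holds at $a$. -/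

import Mathlib

noncomputable section

namespace ConfSphere

open Filter Topology
open scoped LinearAlgebra.Projectivization ContDiff Pointwise

/-! ### The Minkowski space, the Möbius group and the conformal sphere -/

/-- The underlying vector space of the Minkowski space `W = ℝ^{1,n+2}`. -/
abbrev W (n : ℕ) : Type := Fin (n + 3) → ℝ

/-- The Minkowski metric `- v₀ w₀ + v₁ w₁ + ⋯ + v_{n+2} w_{n+2}` of `W`. -/
def mink (n : ℕ) : LinearMap.BilinForm ℝ (W n) :=
  Matrix.toBilin' (Matrix.diagonal (Fin.cons (-1) (fun _ => 1)))

theorem mink_comm {n : ℕ} (v w : W n) : mink n v w = mink n w v := by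
  simp only [mink, Matrix.toBilin'_apply', Matrix.mulVec_diagonal, dotProduct]
  exact Finset.sum_congr rfl fun i _ => by ring

/-- The Möbius group `G = SO(1,n+2)`: linear automorphisms of `W` of determinant one that preserve
the Minkowski metric. -/
def mobiusGroup (n : ℕ) : Subgroup (W n ≃ₗ[ℝ] W n) where
  carrier := {g | (∀ v w, mink n (g v) (g w) = mink n v w) ∧ LinearEquiv.det g = 1}
  mul_mem' := by
    rintro a b ⟨ha, ha'⟩ ⟨hb, hb'⟩
    exact ⟨fun v w => by rw [LinearEquiv.mul_apply, LinearEquiv.mul_apply, ha, hb],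
      by rw [map_mul, ha', hb', one_mul]⟩
  one_mem' := ⟨fun v w => rfl, map_one _⟩
  inv_mem' := by
    rintro a ⟨ha, ha'⟩
    refine ⟨fun v w => ?_, by rw [map_inv, ha', inv_one]⟩
    have h : ∀ x : W n, a (a⁻¹ x) = x := fun x => a.apply_symm_apply x
    rw [← ha (a⁻¹ v) (a⁻¹ w), h, h]

/-- The conformal sphere `𝕊^{n+1} = ℙ W₀`: the set of isotropic lines in `W`. -/
def Sphere (n : ℕ) : Type := {l : ℙ ℝ (W n) // ∀ w ∈ l.submodule, mink n w w = 0}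

theorem isotropic_mk {n : ℕ} {w : W n} (hw : w ≠ 0) (h : mink n w w = 0) :
    ∀ v ∈ (Projectivization.mk ℝ w hw).submodule, mink n v v = 0 := by
  intro v hv
  rw [Projectivization.submodule_mk, Submodule.mem_span_singleton] at hv
  obtain ⟨c, rfl⟩ := hv
  simp [h]

/-- The action of the Möbius group on the conformal sphere. -/
instance {n : ℕ} : MulAction (mobiusGroup n) (Sphere n) where
  smul g a := ⟨g • a.1, by
    obtain ⟨l, hl⟩ := a
    induction l using Projectivization.ind with
    | h v hv =>
      refine isotropic_mk _ ?_
      have h := hl v (by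
        rw [Projectivization.submodule_mk]; exact Submodule.mem_span_singleton_self v)
      exact (g.2.1 v v).trans h⟩
  one_smul a := Subtype.ext (one_smul _ a.1)
  mul_smul g h a := Subtype.ext (mul_smul g h a.1)

/-! ### Standard coordinates -/

/-- A standard basis `p, e₀, e₁, …, eₙ, q` of `W`: `p` and `q` are isotropic with `p · q = 1`, and
`e₀, …, eₙ` is an orthonormal family of vectors orthogonal to `p` and `q`. -/
structure Frame (n : ℕ) where
  p : W n
  q : W n
  e : Fin (n + 1) → W n
  pp : mink n p p = 0
  qq : mink n q q = 0
  pq : mink n p q = 1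
  pe : ∀ i, mink n p (e i) = 0
  qe : ∀ i, mink n q (e i) = 0
  ee : ∀ i j, mink n (e i) (e j) = if i = j then 1 else 0

namespace Frame

variable {n : ℕ} (b : Frame n)

/-- The isotropic vector `p + u e₀ + ∑ xⁱ eᵢ - ½ (u² + ‖x‖²) q`. -/
def lift (u : ℝ) (x : Fin n → ℝ) : W n :=
  b.p + u • b.e 0 + ∑ i, x i • b.e i.succ - ((u ^ 2 + ∑ i, x i ^ 2) / 2) • b.q

theorem mink_q_lift (u : ℝ) (x : Fin n → ℝ) : mink n b.q (b.lift u x) = 1 := by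
  simp [lift, b.qq, b.qe, mink_comm b.q b.p, b.pq, map_sum]

theorem mink_lift (u : ℝ) (x : Fin n → ℝ) : mink n (b.lift u x) (b.lift u x) = 0 := by
  have h0 : ∀ i, mink n (b.e i) b.p = 0 := fun i => by rw [mink_comm, b.pe]
  have h1 : ∀ i, mink n (b.e i) b.q = 0 := fun i => by rw [mink_comm, b.qe]
  have h2 : mink n b.q b.p = 1 := by rw [mink_comm, b.pq]
  simp only [lift, map_add, map_sub, map_smul, map_sum, LinearMap.add_apply, LinearMap.sub_apply,
    LinearMap.smul_apply, LinearMap.sum_apply, b.pp, b.qq, b.pq, b.pe, b.qe, b.ee, h0, h1, h2,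
    smul_eq_mul, Fin.succ_inj, Fin.succ_ne_zero, (Fin.succ_ne_zero _).symm]
  simp
  simp only [← sq]
  ring

theorem lift_ne_zero (u : ℝ) (x : Fin n → ℝ) : b.lift u x ≠ 0 := by
  intro h
  have := b.mink_q_lift u x
  simp [h] at this

/-- The point of the conformal sphere with standard coordinates `(u, x)` with respect to `b`. -/
def chart (u : ℝ) (x : Fin n → ℝ) : Sphere n :=
  ⟨Projectivization.mk ℝ (b.lift u x) (b.lift_ne_zero u x), isotropic_mk _ (b.mink_lift u x)⟩

/-- The image of a standard basis under an element of the Möbius group. -/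
def act (g : mobiusGroup n) : Frame n where
  p := g.1 b.p
  q := g.1 b.q
  e i := g.1 (b.e i)
  pp := by rw [g.2.1, b.pp]
  qq := by rw [g.2.1, b.qq]
  pq := by rw [g.2.1, b.pq]
  pe i := by rw [g.2.1, b.pe]
  qe i := by rw [g.2.1, b.qe]
  ee i j := by rw [g.2.1, b.ee]

theorem act_chart (g : mobiusGroup n) (u : ℝ) (x : Fin n → ℝ) :
    (b.act g).chart u x = g • b.chart u x := by
  apply Subtype.ext
  change Projectivization.mk ℝ _ _ = Projectivization.mk ℝ (g.1 (b.lift u x)) _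
  congr 1
  simp [lift, act, map_sum]

/-- In the standard coordinates of `b`, the set `S` is near the point `(f x₀, x₀)` the graph
`u = f x` of a function `f` that is smooth near `x₀`. -/
def IsGraphAt (S : Set (Sphere n)) (f : (Fin n → ℝ) → ℝ) (x₀ : Fin n → ℝ) : Prop :=
  (∀ᶠ x in 𝓝 x₀, ContDiffAt ℝ ∞ f x) ∧
    ∀ᶠ y : ℝ × (Fin n → ℝ) in 𝓝 (f x₀, x₀), (b.chart y.1 y.2 ∈ S ↔ y.1 = f y.2)

theorem IsGraphAt.smul {b : Frame n} {S : Set (Sphere n)} {f : (Fin n → ℝ) → ℝ} {x₀ : Fin n → ℝ}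
    (h : b.IsGraphAt S f x₀) (g : mobiusGroup n) : (b.act g).IsGraphAt (g • S) f x₀ :=
  ⟨h.1, h.2.mono fun y hy => by rw [act_chart, Set.smul_mem_smul_set_iff]; exact hy⟩

end Frame

/-! ### Hypersurfaces and their two-jets -/

/-- An embedded smooth hypersurface of the conformal sphere: near each of its points it is a smooth
graph in suitable standard coordinates. -/
structure Hypersurface (n : ℕ) where
  carrier : Set (Sphere n)
  isGraph : ∀ a ∈ carrier, ∃ (b : Frame n) (f : (Fin n → ℝ) → ℝ) (x₀ : Fin n → ℝ),
    a = b.chart (f x₀) x₀ ∧ b.IsGraphAt carrier f x₀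

/-- The image of a hypersurface under an element of the Möbius group. -/
def Hypersurface.act {n : ℕ} (g : mobiusGroup n) (S : Hypersurface n) : Hypersurface n where
  carrier := g • S.carrier
  isGraph := by
    rintro _ ⟨a, ha, rfl⟩
    obtain ⟨b, f, x₀, rfl, h⟩ := S.isGraph a ha
    exact ⟨b.act g, f, x₀, (b.act_chart g _ _).symm, h.smul g⟩

/-- A hypersurface together with one of its points. -/
structure PointedHypersurface (n : ℕ) where
  surf : Hypersurface n
  pt : Sphere n
  mem : pt ∈ surf.carrier

/-- The image of a pointed hypersurface under an element of the Möbius group. -/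
def PointedHypersurface.act {n : ℕ} (g : mobiusGroup n) (P : PointedHypersurface n) :
    PointedHypersurface n :=
  ⟨P.surf.act g, g • P.pt, Set.smul_mem_smul_set P.mem⟩

/-- `P.IsGraph b f x₀`: in the standard coordinates of `b` the hypersurface is, near its marked
point, the graph `u = f x`, and the marked point has coordinates `(f x₀, x₀)`. -/
def PointedHypersurface.IsGraph {n : ℕ} (P : PointedHypersurface n) (b : Frame n)
    (f : (Fin n → ℝ) → ℝ) (x₀ : Fin n → ℝ) : Prop :=
  P.pt = b.chart (f x₀) x₀ ∧ b.IsGraphAt P.surf.carrier f x₀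

theorem PointedHypersurface.IsGraph.act {n : ℕ} {P : PointedHypersurface n} {b : Frame n}
    {f : (Fin n → ℝ) → ℝ} {x₀ : Fin n → ℝ} (h : P.IsGraph b f x₀) (g : mobiusGroup n) :
    (P.act g).IsGraph (b.act g) f x₀ :=
  ⟨by rw [Frame.act_chart, ← h.1]; rfl, h.2.smul g⟩

/-- The vector `(∂f/∂x¹, …, ∂f/∂xⁿ)` of first partial derivatives. -/
def grad {n : ℕ} (f : (Fin n → ℝ) → ℝ) (x : Fin n → ℝ) : Fin n → ℝ :=
  fun i => fderiv ℝ f x (Pi.single i 1)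

/-- The matrix of second partial derivatives `∂²f/∂xⁱ∂xʲ`. -/
def hess {n : ℕ} (f : (Fin n → ℝ) → ℝ) (x : Fin n → ℝ) : Matrix (Fin n) (Fin n) ℝ :=
  Matrix.of fun i j => fderiv ℝ (fun y => grad f y j) x (Pi.single i 1)

/-- Two pointed hypersurfaces are `2`-equivalent if, in some standard coordinates in which both are
graphs near the (common) marked point, the Taylor expansions there agree up to order two. -/
def TwoEquiv {n : ℕ} (P₁ P₂ : PointedHypersurface n) : Prop :=
  ∃ (b : Frame n) (f₁ f₂ : (Fin n → ℝ) → ℝ) (x₀ : Fin n → ℝ),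
    P₁.IsGraph b f₁ x₀ ∧ P₂.IsGraph b f₂ x₀ ∧
      f₁ x₀ = f₂ x₀ ∧ grad f₁ x₀ = grad f₂ x₀ ∧ hess f₁ x₀ = hess f₂ x₀

theorem TwoEquiv.act {n : ℕ} {P₁ P₂ : PointedHypersurface n} (h : TwoEquiv P₁ P₂)
    (g : mobiusGroup n) : TwoEquiv (P₁.act g) (P₂.act g) := by
  obtain ⟨b, f₁, f₂, x₀, h₁, h₂, h⟩ := h
  exact ⟨b.act g, f₁, f₂, x₀, h₁.act g, h₂.act g, h⟩

/-- The space `J²(n, 𝕊^{n+1})` of two-jets of hypersurfaces of the conformal sphere. -/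
def J2 (n : ℕ) : Type := Quot (TwoEquiv (n := n))

/-- The two-jet `[S]²_a` of a hypersurface `S` at a point `a ∈ S`. -/
def jet {n : ℕ} (P : PointedHypersurface n) : J2 n := Quot.mk _ P

/-- The action of the Möbius group on two-jets, `[S]²_a ↦ [g(S)]²_{g(a)}`. -/
def J2.act {n : ℕ} (g : mobiusGroup n) : J2 n → J2 n :=
  Quot.map (fun P => P.act g) fun _ _ h => h.act g

/-! ### Second order equations -/

/-- `E ⊆ J²` is invariant under the Möbius group: `g · E = E` for all `g`. -/
def IsInvariant {n : ℕ} (E : Set (J2 n)) : Prop :=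
  ∀ g : mobiusGroup n, J2.act g '' E = E

/-- `E ⊆ J²` is polynomial in the second derivatives: in a system of standard coordinates `(u, x)` it
is given by an equation `Φ(u, x, uᵢ; uᵢⱼ) = 0`, where `Φ` is a polynomial in the second derivatives
`uᵢⱼ` whose coefficients are functions of the coordinates `(u, x, uᵢ)` of the first jet. -/
def IsPolynomial {n : ℕ} (E : Set (J2 n)) : Prop :=
  ∃ (b : Frame n)
    (Φ : ℝ → (Fin n → ℝ) → (Fin n → ℝ) → MvPolynomial (Fin n × Fin n) ℝ),
    ∀ (P : PointedHypersurface n) (f : (Fin n → ℝ) → ℝ) (x : Fin n → ℝ), P.IsGraph b f x →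
      (jet P ∈ E ↔
        MvPolynomial.eval (fun ij => hess f x ij.1 ij.2) (Φ (f x) x (grad f x)) = 0)

/-! ### The conformal shape operator

The lift `(u, x) ↦ p + u e₀ + ∑ xⁱ eᵢ - ½ (u² + ‖x‖²) q` pulls the Minkowski metric back to
`du² + ∑ (dxⁱ)²`, so in standard coordinates the Euclidean metric represents the conformal class. -/

/-- The first fundamental form `gᵢⱼ = δᵢⱼ + uᵢ uⱼ` of the graph `u = f x`. -/
def firstForm {n : ℕ} (f : (Fin n → ℝ) → ℝ) (x : Fin n → ℝ) : Matrix (Fin n) (Fin n) ℝ :=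
  1 + Matrix.vecMulVec (grad f x) (grad f x)

/-- The second fundamental form `βᵢⱼ = uᵢⱼ / √(1 + ∑ uₖ²)` of the graph `u = f x`. -/
def secondForm {n : ℕ} (f : (Fin n → ℝ) → ℝ) (x : Fin n → ℝ) : Matrix (Fin n) (Fin n) ℝ :=
  (Real.sqrt (1 + ∑ k, grad f x k ^ 2))⁻¹ • hess f x

/-- The shape operator `A = g⁻¹ ∘ β` of the graph `u = f x`. -/
def shapeOp {n : ℕ} (f : (Fin n → ℝ) → ℝ) (x : Fin n → ℝ) : Matrix (Fin n) (Fin n) ℝ :=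
  (firstForm f x)⁻¹ * secondForm f x

/-- The conformal shape operator: the traceless part `A_∘ = A - (tr A / n) Id` of `A`. -/
def confShapeOp {n : ℕ} (f : (Fin n → ℝ) → ℝ) (x : Fin n → ℝ) : Matrix (Fin n) (Fin n) ℝ :=
  shapeOp f x - ((shapeOp f x).trace / n) • 1

end ConfSphere

end

noncomputable section
namespace ConfSphere
open Filter Topology
open scoped LinearAlgebra.Projectivization ContDiff Pointwise

/-! ### Symmetric polynomials and power sums -/

/-! Every 2-jet has a normal form. At a point of a graph, take as new origin the point itself, as
`e₀` the unit normal, and as the other `eⱼ` an orthonormal tangent basis. Two freedoms remain.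
Replacing the hyperplane `u = 0` by a tangent sphere of curvature `-c` changes the second form by
`c` times the first form, and rescaling `p, q` multiplies it by a nonzero factor. Removing the trace
and using principal directions, the jet becomes that of the quadric `u = ½ ∑ lⱼ (xʲ)²`, where `l` is
any nonzero multiple of the eigenvalues of `A_∘`, in any order. This is
`PointedHypersurface.IsGraph.exists_jet_eq`.

Standard bases are permuted transitively by `O(1,n+2)`. The quadric is even in each `xʲ`, so a
reflection in some `eⱼ` preserves it and `SO(1,n+2)` suffices (`jet_quadricHypersurface_mem_iff`).
An invariant `E` may therefore be tested on quadrics at the origin of the one coordinate system in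
which `E` is polynomial. There the condition is `ψ(l) = 0`, with `ψ` the restriction of `Φ 0 0 0` to
diagonal matrices, and its truth is the same for all positive multiples and all permutations of `l`
(`jet_mem_iff_eval_eq_zero`).

It remains to turn `ψ` into an `F`. Over `ℝ` the sum of the squares of all permutations of `ψ` is a
symmetric polynomial whose zeros are the common zeros of the permuted `ψ`. On `∑ lᵢ = 0` it is a
polynomial `G` in the power sums of degrees `2, …, n` (`exists_eval_powerSums`). Vanishing of `G`
along a whole ray means vanishing of all its weighted components `G_k`. These are combined into the
single weighted homogeneous `∑ G_k² τ₂^(N-k)`, since `tr(A_∘²)` is positive unless `A_∘ = 0`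
(`exists_isWeightedHomogeneous_eval_powerSums`). -/

open MvPolynomial in
/-- On the hyperplane `∑ lᵢ = 0` every symmetric polynomial is a polynomial in the power sums of
degrees `2, …, n`. -/
theorem exists_eval_powerSums {n : ℕ} {Q : MvPolynomial (Fin n) ℝ} (hQ : Q.IsSymmetric) :
    ∃ F : MvPolynomial (Finset.Icc 2 n) ℝ, ∀ l : Fin n → ℝ, ∑ i, l i = 0 →
      eval l Q = eval (fun h : Finset.Icc 2 n => ∑ i, l i ^ (h : ℕ)) F := by
  -- The class `R` is closed under sums and products, so it suffices that it contains the constants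
  -- and the elementary symmetric polynomials.
  let R (A : MvPolynomial (Fin n) ℝ) : Prop := ∃ F : MvPolynomial (Finset.Icc 2 n) ℝ,
    ∀ l : Fin n → ℝ, ∑ i, l i = 0 →
      eval l A = eval (fun h : Finset.Icc 2 n => ∑ i, l i ^ (h : ℕ)) F
  change R Q
  have hadd : ∀ A B, R A → R B → R (A + B) := by
    rintro A B ⟨F, hF⟩ ⟨G, hG⟩
    exact ⟨F + G, fun l hl => by rw [map_add, map_add, hF l hl, hG l hl]⟩
  have hmul : ∀ A B, R A → R B → R (A * B) := by
    rintro A B ⟨F, hF⟩ ⟨G, hG⟩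
    exact ⟨F * G, fun l hl => by rw [map_mul, map_mul, hF l hl, hG l hl]⟩
  have hC : ∀ c : ℝ, R (C c) := fun c => ⟨C c, fun l hl => by rw [eval_C, eval_C]⟩
  have hpsum : ∀ k ≤ n, R (psum (Fin n) ℝ k) := by
    intro k hk
    rcases Nat.lt_or_ge k 2 with h2 | h2
    -- The power sum of degree 0 is the constant `n`; that of degree 1 vanishes, and this is the
    -- only place where the hyperplane enters.
    · interval_cases k
      · exact ⟨C n, fun l hl => by simp [psum]⟩
      · exact ⟨0, fun l hl => by simp [psum, hl]⟩
    · exact ⟨X ⟨k, Finset.mem_Icc.2 ⟨h2, hk⟩⟩, fun l hl => by simp [psum]⟩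
  have hesymm : ∀ k ≤ n, R (esymm (Fin n) ℝ k) := by
    intro k
    induction k using Nat.strong_induction_on with
    | _ k ih =>
      intro hk
      rcases Nat.eq_zero_or_pos k with rfl | hpos
      · rw [esymm_zero, ← C_1]; exact hC 1
      -- Newton's identity, divided by `k`, expresses `e_k` through power sums and lower `e_j`.
      have key : esymm (Fin n) ℝ k = C ((k : ℝ)⁻¹ * (-1) ^ (k + 1)) *
          ∑ a ∈ Finset.HasAntidiagonal.antidiagonal k with a.1 < k,
            C ((-1) ^ a.1) * esymm (Fin n) ℝ a.1 * psum (Fin n) ℝ a.2 := by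
        have hN := mul_esymm_eq_sum (Fin n) ℝ k
        have hk0 : (k : ℝ) ≠ 0 := by positivity
        have h1 : (C ((k : ℝ)⁻¹) : MvPolynomial (Fin n) ℝ) * (k : MvPolynomial (Fin n) ℝ) = 1 := by
          rw [← map_natCast (C : ℝ →+* MvPolynomial (Fin n) ℝ), ← C_mul, inv_mul_cancel₀ hk0, C_1]
        calc esymm (Fin n) ℝ k
            = C ((k : ℝ)⁻¹) * ((k : MvPolynomial (Fin n) ℝ) * esymm (Fin n) ℝ k) := by
              rw [← mul_assoc, h1, one_mul]
          _ = _ := by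
              rw [hN]
              simp [mul_assoc]
      rw [key]
      refine hmul _ _ (hC _) ?_
      refine Finset.sum_induction _ R hadd (by rw [← C_0]; exact hC 0) fun a ha => ?_
      rw [Finset.mem_filter, Finset.HasAntidiagonal.mem_antidiagonal] at ha
      exact hmul _ _ (hmul _ _ (hC _) (ih a.1 ha.2 (by omega))) (hpsum a.2 (by omega))
  obtain ⟨G, hG⟩ := esymmAlgHom_surjective (σ := Fin n) (n := n) ℝ (by simp) ⟨Q, hQ⟩
  have hG' : aeval (fun i : Fin n => esymm (Fin n) ℝ (i + 1)) G = Q := by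
    rw [← esymmAlgHom_apply, hG]
  rw [← hG']
  clear hG hG' hQ
  induction G using MvPolynomial.induction_on with
  | C a => rw [algHom_C]; exact hC a
  | add p q hp hq => rw [map_add]; exact hadd _ _ hp hq
  | mul_X p i hp =>
    rw [map_mul, aeval_X]
    exact hmul _ _ hp (hesymm _ (by omega))

open MvPolynomial in
theorem eval_scale_of_isWeightedHomogeneous {σ : Type*} {w : σ → ℕ} {φ : MvPolynomial σ ℝ} {d : ℕ}
    (hφ : φ.IsWeightedHomogeneous w d) (t : ℝ) (c : σ → ℝ) :
    eval (fun h => t ^ w h * c h) φ = t ^ d * eval c φ := by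
  rw [eval_eq, eval_eq, Finset.mul_sum]
  refine Finset.sum_congr rfl fun m hm => ?_
  have hw := hφ (mem_support_iff.1 hm)
  rw [← hw, Finsupp.weight_apply, Finsupp.sum, Finset.prod_congr rfl fun i _ => mul_pow _ _ _,
    Finset.prod_mul_distrib, ← Finset.prod_pow_eq_pow_sum]
  simp only [smul_eq_mul, ← pow_mul, mul_comm (w _)]
  ring

open MvPolynomial in
/-- The largest conical subset of the zero set, on the hyperplane `∑ lᵢ = 0`, of a polynomial in the
power sums is the zero set of a weighted homogeneous polynomial in the power sums. -/
theorem exists_isWeightedHomogeneous_eval_powerSums {n : ℕ} (hn : 1 ≤ n)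
    (G : MvPolynomial (Finset.Icc 2 n) ℝ) :
    ∃ (d : ℕ) (F : MvPolynomial (Finset.Icc 2 n) ℝ),
      F.IsWeightedHomogeneous (fun h : Finset.Icc 2 n => (h : ℕ)) d ∧
      ∀ l : Fin n → ℝ,
        ((∀ t : ℝ, 0 < t → eval (fun h : Finset.Icc 2 n => ∑ i, (t * l i) ^ (h : ℕ)) G = 0) ↔
          eval (fun h : Finset.Icc 2 n => ∑ i, l i ^ (h : ℕ)) F = 0) := by
  classical
  -- For `n = 1` there is no variable `τ₂` to homogenize with, but then `G` is a constant.
  rcases hn.eq_or_lt with rfl | hn2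
  · have : IsEmpty (Finset.Icc 2 1) := ⟨fun h => by have := Finset.mem_Icc.1 h.2; omega⟩
    refine ⟨0, G, isWeightedHomogeneous_of_isEmpty _ _ _, fun l => ?_⟩
    rw [G.eq_C_of_isEmpty]
    simp only [eval_C]
    exact ⟨fun h => h 1 one_pos, fun h _ _ => h⟩
  set w : Finset.Icc 2 n → ℕ := fun h => (h : ℕ) with hw
  set N := weightedTotalDegree w G with hN
  have hsum : G = ∑ k ∈ Finset.range (N + 1), weightedHomogeneousComponent w k G := by
    conv_lhs => rw [← sum_weightedHomogeneousComponent w G]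
    rw [finsum_eq_sum_of_support_subset]
    intro k hk
    simp only [Finset.coe_range, Set.mem_Iio]
    by_contra hlt
    exact hk (weightedHomogeneousComponent_eq_zero k G (by omega))
  have hcone : ∀ l : Fin n → ℝ,
      ((∀ t : ℝ, 0 < t → eval (fun h : Finset.Icc 2 n => ∑ i, (t * l i) ^ (h : ℕ)) G = 0) ↔
        ∀ k ∈ Finset.range (N + 1), eval (fun h : Finset.Icc 2 n => ∑ i, l i ^ (h : ℕ))
          (weightedHomogeneousComponent w k G) = 0) := by
    intro l
    have hev : ∀ t : ℝ, eval (fun h : Finset.Icc 2 n => ∑ i, (t * l i) ^ (h : ℕ)) G =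
        ∑ k ∈ Finset.range (N + 1), t ^ k *
          eval (fun h : Finset.Icc 2 n => ∑ i, l i ^ (h : ℕ))
            (weightedHomogeneousComponent w k G) := by
      intro t
      conv_lhs => rw [hsum, map_sum]
      refine Finset.sum_congr rfl fun k _ => ?_
      rw [← eval_scale_of_isWeightedHomogeneous
        (weightedHomogeneousComponent_isWeightedHomogeneous k G)]
      simp only [mul_pow, Finset.mul_sum, hw]
    constructor
    · intro h k hk
      set q : Polynomial ℝ := ∑ k ∈ Finset.range (N + 1), Polynomial.monomial k
        (eval (fun h : Finset.Icc 2 n => ∑ i, l i ^ (h : ℕ))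
            (weightedHomogeneousComponent w k G)) with hq
      -- Along a ray, `G` is a polynomial in `t` whose coefficients are the values of the weighted
      -- components. It has infinitely many roots, so all of these values vanish.
      have hq0 : q = 0 := by
        refine Polynomial.eq_zero_of_infinite_isRoot q ((Set.Ioi_infinite (0 : ℝ)).mono ?_)
        intro t ht
        have := h t ht
        rw [hev] at this
        simp only [Set.mem_ofPred_eq, Polynomial.IsRoot.def, hq, Polynomial.eval_finsetSum,
          Polynomial.eval_monomial]
        rw [← this]
        exact Finset.sum_congr rfl fun _ _ => mul_comm _ _
      have := congrArg (fun p => Polynomial.coeff p k) hq0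
      simpa [hq, Polynomial.finsetSum_coeff, Polynomial.coeff_monomial, Finset.mem_range.1 hk]
        using this
    · intro h t _
      rw [hev]
      exact Finset.sum_eq_zero fun k hk => by rw [h k hk, mul_zero]
  have hw0 : ∀ i, w i ≠ 0 := by
    intro i
    have := (Finset.mem_Icc.1 i.2).1
    simp only [hw]; omega
  by_cases h0 : weightedHomogeneousComponent w 0 G = 0
  swap
  -- A nonzero constant component vanishes nowhere, so the conical set is empty and `F = 1`
  -- describes it.
  · refine ⟨0, 1, isWeightedHomogeneous_one ℝ w, fun l => ?_⟩
    simp only [hcone, map_one, one_ne_zero, iff_false]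
    intro h
    have h1 := h 0 (by simp)
    rw [weightedHomogeneousComponent_zero _ hw0] at h1 h0
    rw [eval_C] at h1
    rw [h1, C_0] at h0
    exact h0 rfl
  let two : Finset.Icc 2 n := ⟨2, Finset.mem_Icc.2 ⟨le_rfl, hn2⟩⟩
  -- The square of the component of weight `k` has weight `2k`, and `τ₂^(N-k)` raises it to `2N`.
  -- Since `τ₂` takes the value `∑ lᵢ² ≥ 0`, the sum vanishes only if every term does.
  refine ⟨2 * N, ∑ k ∈ Finset.range (N + 1),
    weightedHomogeneousComponent w k G ^ 2 * X two ^ (N - k), ?_, fun l => ?_⟩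
  · refine IsWeightedHomogeneous.sum _ _ _ fun k hk => ?_
    have hk' := Finset.mem_range.1 hk
    have := ((weightedHomogeneousComponent_isWeightedHomogeneous (w := w) k G).pow 2).mul
      ((isWeightedHomogeneous_X ℝ w two).pow (N - k))
    convert this using 1
    simp only [hw, two, smul_eq_mul]
    omega
  rw [hcone]
  simp only [map_sum, map_mul, map_pow, eval_X]
  rw [Finset.sum_eq_zero_iff_of_nonneg fun k _ => by
    refine mul_nonneg (sq_nonneg _) (pow_nonneg (Finset.sum_nonneg fun i _ => ?_) _)
    exact sq_nonneg _]
  refine forall₂_congr fun k hk => ?_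
  constructor
  · intro h; rw [h]; simp
  intro h
  rcases mul_eq_zero.1 h with h | h
  · exact pow_eq_zero_iff two_ne_zero |>.1 h
  -- If the factor `τ₂^(N-k)` vanishes, then `l = 0`. There the components of positive weight vanish
  -- (scaling by `t = 0`), and the one of weight 0 is zero by `h0`.
  have hl := eq_zero_of_pow_eq_zero h
  have hl0 : ∀ i, l i = 0 := by
    intro i
    have := (Finset.sum_eq_zero_iff_of_nonneg fun i _ => sq_nonneg (l i)).1 hl i (Finset.mem_univ _)
    exact pow_eq_zero_iff two_ne_zero |>.1 this
  rcases Nat.eq_zero_or_pos k with rfl | hk0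
  · rw [h0, map_zero]
  have hz := eval_scale_of_isWeightedHomogeneous
    (weightedHomogeneousComponent_isWeightedHomogeneous (w := w) k G) 0
    (fun h : Finset.Icc 2 n => ∑ i, l i ^ (h : ℕ))
  rw [zero_pow hk0.ne', zero_mul] at hz
  rw [← hz]
  congr 1
  congr 1
  funext h
  have := (Finset.mem_Icc.1 h.2).1
  have h0' : (h : ℕ) ≠ 0 := by omega
  simp [hl0, h0', hw]

/-! ### Standard bases -/

namespace Frame
variable {n : ℕ} (b : Frame n)

theorem mink_e_p (i : Fin (n + 1)) : mink n (b.e i) b.p = 0 := by rw [mink_comm, b.pe]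

theorem mink_e_q (i : Fin (n + 1)) : mink n (b.e i) b.q = 0 := by rw [mink_comm, b.qe]

theorem mink_q_p : mink n b.q b.p = 1 := by rw [mink_comm, b.pq]

/-- The vectors of a standard basis as a family. -/
def vec : Fin (n + 1) ⊕ Bool → W n :=
  Sum.elim b.e fun c => cond c b.p b.q

theorem linearIndependent_vec : LinearIndependent ℝ b.vec := by
  rw [Fintype.linearIndependent_iff]
  intro c hc
  simp only [vec, Fintype.sum_sum_type, Sum.elim_inl, Sum.elim_inr, Fintype.sum_bool, cond_true,
    cond_false] at hc
  -- Pairing with `q`, `p` and `eⱼ` isolates the coefficients of `p`, `q` and `eⱼ` respectively.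
  have hp := congrArg (fun w => mink n w b.q) hc
  have hq := congrArg (fun w => mink n w b.p) hc
  have he := fun j => congrArg (fun w => mink n w (b.e j)) hc
  simp [b.pp, b.qq, b.pq, b.pe, b.qe, b.ee, b.mink_e_p, b.mink_e_q, b.mink_q_p] at hp hq he
  rintro (i | c)
  · exact he i
  · cases c
    · exact hq
    · exact hp

/-- A standard basis as a basis of `W`. -/
def basis : Module.Basis (Fin (n + 1) ⊕ Bool) ℝ (W n) :=
  basisOfLinearIndependentOfCardEqFinrank b.linearIndependent_vec (by simp)

@[simp] theorem coe_basis : ⇑b.basis = b.vec :=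
  coe_basisOfLinearIndependentOfCardEqFinrank _ _

/-- The basis dual to `p, e₀, …, eₙ, q` for the Minkowski metric is the same basis with `p` and `q`
exchanged. -/
theorem expand (w : W n) :
    w = mink n w b.q • b.p + ∑ i, mink n w (b.e i) • b.e i + mink n w b.p • b.q := by
  have h : LinearMap.id = ((mink n).flip b.q).smulRight b.p
      + ∑ i, ((mink n).flip (b.e i)).smulRight (b.e i) + ((mink n).flip b.p).smulRight b.q := by
    refine b.basis.ext fun i => ?_
    rcases i with i | c
    · simp [vec, b.ee, b.mink_e_p, b.mink_e_q]
    · cases c <;> simp [vec, b.pp, b.qq, b.pq, b.pe, b.qe, b.mink_q_p]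
  simpa using LinearMap.congr_fun h w

theorem mink_lift_q (u : ℝ) (x : Fin n → ℝ) : mink n (b.lift u x) b.q = 1 := by
  rw [mink_comm, mink_q_lift]

theorem mink_lift_e_zero (u : ℝ) (x : Fin n → ℝ) : mink n (b.lift u x) (b.e 0) = u := by
  simp [lift, b.qe, b.pe, b.ee]

theorem mink_lift_e_succ (u : ℝ) (x : Fin n → ℝ) (i : Fin n) :
    mink n (b.lift u x) (b.e i.succ) = x i := by
  simp [lift, b.qe, b.pe, b.ee, (Fin.succ_ne_zero _).symm]

theorem mink_lift_p (u : ℝ) (x : Fin n → ℝ) :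
    mink n (b.lift u x) b.p = -((u ^ 2 + ∑ i, x i ^ 2) / 2) := by
  simp [lift, b.mink_q_p, b.pp, b.mink_e_p]

/-- The standard coordinates of an isotropic line are the quotients of the products of a spanning
vector with the basis vectors. -/
theorem mk_eq_chart_iff {w : W n} (hw : w ≠ 0) (h : mink n w w = 0) (u : ℝ) (x : Fin n → ℝ) :
    (⟨Projectivization.mk ℝ w hw, isotropic_mk hw h⟩ : Sphere n) = b.chart u x ↔
      mink n w b.q ≠ 0 ∧ mink n w (b.e 0) = mink n w b.q * u ∧
        ∀ i : Fin n, mink n w (b.e i.succ) = mink n w b.q * x i := by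
  rw [chart, Subtype.mk.injEq, Projectivization.mk_eq_mk_iff']
  constructor
  · rintro ⟨a, rfl⟩
    have ha : a ≠ 0 := by rintro rfl; simp at hw
    simp [mink_lift_q, mink_lift_e_zero, mink_lift_e_succ, ha]
  · rintro ⟨hc, h0, hi⟩
    refine ⟨mink n w b.q, ?_⟩
    have hE := b.expand w
    -- Isotropy of `w` fixes its coefficient of `q` in terms of the others, as long as its
    -- coefficient of `p` is nonzero.
    have hnull : 2 * mink n w b.p + mink n w b.q * (u ^ 2 + ∑ i, x i ^ 2) = 0 := by
      have h1 := congrArg (fun v => mink n w v) hE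
      simp only [h, map_add, map_sum, map_smul, smul_eq_mul, Fin.sum_univ_succ, h0, hi] at h1
      have h2 : mink n w b.q * (2 * mink n w b.p + mink n w b.q * (u ^ 2 + ∑ i, x i ^ 2)) = 0 := by
        rw [h1, mul_add (mink n w b.q) (u ^ 2), Finset.mul_sum, mul_add, mul_add, Finset.mul_sum,
          Finset.sum_congr rfl fun i _ =>
            (show mink n w b.q * x i * (mink n w b.q * x i)
              = mink n w b.q * (mink n w b.q * x i ^ 2) by ring)]
        ring
      exact (mul_eq_zero.1 h2).resolve_left hc
    have hp : mink n w b.p = -(mink n w b.q * ((u ^ 2 + ∑ i, x i ^ 2) / 2)) := by linarith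
    conv_rhs => rw [hE, Fin.sum_univ_succ, h0, hp]
    simp only [hi, lift, smul_sub, smul_add, Finset.smul_sum, smul_smul, neg_smul]
    abel

theorem chart_eq_chart_iff (b' : Frame n) (u u' : ℝ) (x x' : Fin n → ℝ) :
    b.chart u x = b'.chart u' x' ↔
      mink n (b.lift u x) b'.q ≠ 0 ∧
        mink n (b.lift u x) (b'.e 0) = mink n (b.lift u x) b'.q * u' ∧
        ∀ i : Fin n, mink n (b.lift u x) (b'.e i.succ) = mink n (b.lift u x) b'.q * x' i :=
  b'.mk_eq_chart_iff (b.lift_ne_zero u x) (b.mink_lift u x) u' x'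

theorem chart_injective {u u' : ℝ} {x x' : Fin n → ℝ} (h : b.chart u x = b.chart u' x') :
    u = u' ∧ x = x' := by
  have := (b.chart_eq_chart_iff b u u' x x').1 h
  simp only [mink_lift_q, mink_lift_e_zero, mink_lift_e_succ, one_mul] at this
  exact ⟨this.2.1, funext this.2.2⟩

/-- Two standard bases with the same vectors agree. -/
theorem ext_vec {b b' : Frame n} (h : b.vec = b'.vec) : b = b' := by
  have hp : b.p = b'.p := congrFun h (Sum.inr true)
  have hq : b.q = b'.q := congrFun h (Sum.inr false)
  have he : b.e = b'.e := funext fun i => congrFun h (Sum.inl i)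
  cases b; cases b'
  simp only at hp hq he
  subst hp hq he
  rfl

/-- The linear automorphism taking one standard basis to another. -/
def trans (b' : Frame n) : W n ≃ₗ[ℝ] W n := b.basis.equiv b'.basis (Equiv.refl _)

theorem trans_vec (b' : Frame n) (i : Fin (n + 1) ⊕ Bool) : b.trans b' (b.vec i) = b'.vec i := by
  have := b.basis.equiv_apply i b'.basis (Equiv.refl _)
  rw [coe_basis, coe_basis] at this
  exact this

theorem mink_vec (b' : Frame n) (i j : Fin (n + 1) ⊕ Bool) :
    mink n (b.vec i) (b.vec j) = mink n (b'.vec i) (b'.vec j) := by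
  rcases i with i | (_ | _) <;> rcases j with j | (_ | _) <;>
    simp [vec, b.pp, b.qq, b.pq, b.pe, b.qe, b.ee, b.mink_e_p, b.mink_e_q, b.mink_q_p,
      b'.pp, b'.qq, b'.pq, b'.pe, b'.qe, b'.ee, b'.mink_e_p, b'.mink_e_q, b'.mink_q_p]

theorem mink_trans (b' : Frame n) (v w : W n) :
    mink n (b.trans b' v) (b.trans b' w) = mink n v w := by
  have h : (mink n).compl₁₂ (b.trans b' : W n →ₗ[ℝ] W n) (b.trans b' : W n →ₗ[ℝ] W n) = mink n := by
    refine LinearMap.BilinForm.ext_basis b.basis fun i j => ?_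
    simp only [coe_basis, LinearMap.compl₁₂_apply, LinearEquiv.coe_coe, trans_vec]
    exact (b.mink_vec b' i j).symm
  exact LinearMap.congr_fun₂ h v w

/-- The standard basis with `eⱼ` replaced by `-eⱼ`. -/
def flip (j : Fin n) : Frame n where
  p := b.p
  q := b.q
  e i := (if i = j.succ then (-1 : ℝ) else 1) • b.e i
  pp := b.pp
  qq := b.qq
  pq := b.pq
  pe i := by rw [map_smul, b.pe, smul_zero]
  qe i := by rw [map_smul, b.qe, smul_zero]
  ee i k := by
    simp only [map_smul, LinearMap.smul_apply, b.ee, smul_eq_mul]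
    by_cases hik : i = k
    · subst hik; rw [if_pos rfl]; split_ifs <;> simp
    · simp [hik]

theorem det_trans_flip (j : Fin n) :
    LinearMap.det (b.trans (b.flip j) : W n →ₗ[ℝ] W n) = -1 := by
  rw [← LinearMap.det_toMatrix b.basis]
  have : LinearMap.toMatrix b.basis b.basis (b.trans (b.flip j) : W n →ₗ[ℝ] W n) =
      Matrix.diagonal fun i => if i = Sum.inl j.succ then (-1 : ℝ) else 1 := by
    ext i k
    have hk : b.trans (b.flip j) (b.basis k) =
        (if k = Sum.inl j.succ then (-1 : ℝ) else 1) • b.basis k := by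
      rw [coe_basis, trans_vec]
      rcases k with k | (_ | _) <;> simp [vec, flip]
    rw [LinearMap.toMatrix_apply, LinearEquiv.coe_coe, hk, map_smul, Module.Basis.repr_self,
      Matrix.diagonal_apply]
    by_cases hik : i = k
    · subst hik; rw [if_pos rfl]; split_ifs <;> simp
    · split_ifs <;> simp [hik]
  rw [this, Matrix.det_diagonal, Finset.prod_ite_eq' Finset.univ (Sum.inl j.succ) fun _ => (-1 : ℝ)]
  simp

end Frame

/-- Taking determinants in `gᵀ D g = D` gives `(det g)² = 1`, because `det D ≠ 0`. -/
theorem det_eq_one_or_neg_one {n : ℕ} {g : W n ≃ₗ[ℝ] W n}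
    (hg : ∀ v w, mink n (g v) (g w) = mink n v w) :
    LinearMap.det (g : W n →ₗ[ℝ] W n) = 1 ∨ LinearMap.det (g : W n →ₗ[ℝ] W n) = -1 := by
  set D : Matrix (Fin (n + 3)) (Fin (n + 3)) ℝ := Matrix.diagonal (Fin.cons (-1) fun _ => 1) with hD
  have h : (mink n).comp (g : W n →ₗ[ℝ] W n) (g : W n →ₗ[ℝ] W n) = mink n :=
    LinearMap.ext₂ hg
  have h2 := congrArg (fun B => (LinearMap.BilinForm.toMatrix' B).det) h
  have hm : LinearMap.BilinForm.toMatrix' (mink n) = D := LinearMap.BilinForm.toMatrix'_toBilin' D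
  have hdet : D.det = -1 := by
    rw [hD, Matrix.det_diagonal, Fin.prod_univ_succ]; simp
  simp only [LinearMap.BilinForm.toMatrix'_comp, Matrix.det_mul, Matrix.det_transpose, hm, hdet,
    LinearMap.det_toMatrix'] at h2
  exact mul_self_eq_one_iff.1 (by linarith)

/-- Up to a reflection in one of the vectors, any two standard bases are related by the Möbius
group. -/
theorem Frame.exists_act_eq {n : ℕ} (b b' : Frame n) (j : Fin n) :
    ∃ g : mobiusGroup n, b.act g = b' ∨ b.act g = b'.flip j := by
  rcases det_eq_one_or_neg_one (b.mink_trans b') with h | h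
  · refine ⟨⟨b.trans b', b.mink_trans b', ?_⟩, Or.inl (Frame.ext_vec ?_)⟩
    · apply Units.ext; rw [LinearEquiv.coe_det, h]; rfl
    · funext i
      rw [← b.trans_vec b' i]
      rcases i with i | (_ | _) <;> rfl
  -- A transition of determinant `-1` is corrected by composing it with the reflection in `eⱼ` of
  -- the target basis.
  · refine ⟨⟨b'.trans (b'.flip j) * b.trans b', fun v w => ?_, ?_⟩, Or.inr (Frame.ext_vec ?_)⟩
    · rw [LinearEquiv.mul_apply, LinearEquiv.mul_apply, Frame.mink_trans, Frame.mink_trans]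
    · apply Units.ext
      rw [map_mul, Units.val_mul, LinearEquiv.coe_det, LinearEquiv.coe_det, h,
        Frame.det_trans_flip]
      norm_num
    · funext i
      rw [← b'.trans_vec (b'.flip j) i, ← b.trans_vec b' i]
      rcases i with i | (_ | _) <;> rfl

/-! ### Two-jets of functions -/

/-- The function `f` is twice continuously differentiable at `x₀` with value `c`, gradient `v` and
Hessian `H`. -/
structure HasTwoJetAt {n : ℕ} (f : (Fin n → ℝ) → ℝ) (x₀ : Fin n → ℝ) (c : ℝ) (v : Fin n → ℝ)
    (H : Matrix (Fin n) (Fin n) ℝ) : Prop where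
  contDiffAt : ContDiffAt ℝ 2 f x₀
  value : f x₀ = c
  grad : grad f x₀ = v
  hess : hess f x₀ = H

theorem hess_apply {n : ℕ} (f : (Fin n → ℝ) → ℝ) (x : Fin n → ℝ) (i j : Fin n) :
    hess f x i j = fderiv ℝ (fun y => fderiv ℝ f y (Pi.single j 1)) x (Pi.single i 1) := rfl

theorem grad_congr {n : ℕ} {f g : (Fin n → ℝ) → ℝ} {x₀ : Fin n → ℝ} (h : f =ᶠ[𝓝 x₀] g) :
    grad f x₀ = grad g x₀ := by
  funext i; simp only [grad, h.fderiv_eq]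

theorem hess_congr {n : ℕ} {f g : (Fin n → ℝ) → ℝ} {x₀ : Fin n → ℝ} (h : f =ᶠ[𝓝 x₀] g) :
    hess f x₀ = hess g x₀ := by
  ext i j
  rw [hess_apply, hess_apply, Filter.EventuallyEq.fderiv_eq]
  filter_upwards [h.fderiv (𝕜 := ℝ)] with y hy
  rw [hy]

theorem differentiableAt_fderiv_apply {E : Type*} [NormedAddCommGroup E] [NormedSpace ℝ E]
    {f : E → ℝ} {x₀ : E} (h : ContDiffAt ℝ 2 f x₀) (v : E) :
    DifferentiableAt ℝ (fun y => fderiv ℝ f y v) x₀ := by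
  have h1 : ContDiffAt ℝ 1 (fderiv ℝ f) x₀ := h.fderiv_right (by norm_num)
  exact (h1.differentiableAt one_ne_zero).clm_apply (differentiableAt_const v)

theorem isSymm_hess {n : ℕ} {f : (Fin n → ℝ) → ℝ} {x₀ : Fin n → ℝ} (h : ContDiffAt ℝ 2 f x₀) :
    (hess f x₀).IsSymm := by
  have h1 : ContDiffAt ℝ 1 (fderiv ℝ f) x₀ := h.fderiv_right (by norm_num)
  have h2 := h1.differentiableAt one_ne_zero
  have key : ∀ i j, hess f x₀ i j = fderiv ℝ (fderiv ℝ f) x₀ (Pi.single i 1) (Pi.single j 1) := by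
    intro i j
    rw [hess_apply, fderiv_clm_apply h2 (differentiableAt_const _)]
    simp
  ext i j
  rw [Matrix.transpose_apply, key, key]
  exact h.isSymmSndFDerivAt (by simp) _ _

namespace HasTwoJetAt
variable {n : ℕ} {f g : (Fin n → ℝ) → ℝ} {x₀ : Fin n → ℝ} {c d : ℝ} {v w : Fin n → ℝ}
  {H K : Matrix (Fin n) (Fin n) ℝ}

theorem of_contDiffAt (h : ContDiffAt ℝ 2 f x₀) :
    HasTwoJetAt f x₀ (f x₀) (ConfSphere.grad f x₀) (ConfSphere.hess f x₀) :=
  ⟨h, rfl, rfl, rfl⟩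

theorem const (c : ℝ) : HasTwoJetAt (fun _ : Fin n → ℝ => c) x₀ c 0 0 := by
  refine ⟨contDiffAt_const, rfl, ?_, ?_⟩
  · funext i; simp [ConfSphere.grad]
  · ext i j; simp [hess_apply]

theorem clm (L : (Fin n → ℝ) →L[ℝ] ℝ) (e : ℝ) :
    HasTwoJetAt (fun x => L x + e) x₀ (L x₀ + e) (fun i => L (Pi.single i 1)) 0 := by
  have h : ∀ y, fderiv ℝ (fun x => L x + e) y = L := fun y => by
    rw [fderiv_add_const]; exact L.fderiv
  refine ⟨L.contDiff.contDiffAt.add contDiffAt_const, rfl, ?_, ?_⟩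
  · funext i; simp only [ConfSphere.grad, h]
  · ext i j; simp [hess_apply, h]

theorem linear (a : Fin n → ℝ) :
    HasTwoJetAt (fun x => ∑ i, a i * (x i - x₀ i)) x₀ 0 a 0 := by
  have h := clm (x₀ := x₀) (∑ i, a i • ContinuousLinearMap.proj (R := ℝ) (φ := fun _ : Fin n => ℝ) i)
    (-∑ i, a i * x₀ i)
  have e1 : (fun x : Fin n → ℝ => ∑ i, a i * (x i - x₀ i)) = fun x =>
      (∑ i, a i • ContinuousLinearMap.proj (R := ℝ) (φ := fun _ : Fin n => ℝ) i) x
        + -∑ i, a i * x₀ i := by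
    funext x
    simp [mul_add, Finset.sum_add_distrib, sub_eq_add_neg]
  rw [e1]
  convert h using 1
  · simp
  · funext i
    simp [Pi.single_apply]

theorem add (hf : HasTwoJetAt f x₀ c v H) (hg : HasTwoJetAt g x₀ d w K) :
    HasTwoJetAt (fun x => f x + g x) x₀ (c + d) (v + w) (H + K) := by
  have h1 : fderiv ℝ (fun x => f x + g x) =ᶠ[𝓝 x₀] fun y => fderiv ℝ f y + fderiv ℝ g y := by
    filter_upwards [hf.contDiffAt.eventually (by simp), hg.contDiffAt.eventually (by simp)]
      with y hy hy'
    exact fderiv_fun_add (hy.differentiableAt two_ne_zero) (hy'.differentiableAt two_ne_zero)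
  refine ⟨hf.contDiffAt.add hg.contDiffAt, by rw [hf.value, hg.value], ?_, ?_⟩
  · rw [← hf.grad, ← hg.grad]
    funext i
    simp only [ConfSphere.grad, h1.eq_of_nhds, Pi.add_apply, add_apply]
  · rw [← hf.hess, ← hg.hess]
    ext i j
    have h2 : (fun y => fderiv ℝ (fun x => f x + g x) y (Pi.single j 1)) =ᶠ[𝓝 x₀]
        fun y => fderiv ℝ f y (Pi.single j 1) + fderiv ℝ g y (Pi.single j 1) := by
      filter_upwards [h1] with y hy
      rw [hy]; rfl
    rw [hess_apply, h2.fderiv_eq, fderiv_fun_add (differentiableAt_fderiv_apply hf.contDiffAt _)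
      (differentiableAt_fderiv_apply hg.contDiffAt _)]
    rfl

theorem mul (hf : HasTwoJetAt f x₀ c v H) (hg : HasTwoJetAt g x₀ d w K) :
    HasTwoJetAt (fun x => f x * g x) x₀ (c * d) (c • w + d • v)
      (c • K + d • H + Matrix.vecMulVec v w + Matrix.vecMulVec w v) := by
  have h1 : fderiv ℝ (fun x => f x * g x) =ᶠ[𝓝 x₀]
      fun y => f y • fderiv ℝ g y + g y • fderiv ℝ f y := by
    filter_upwards [hf.contDiffAt.eventually (by simp), hg.contDiffAt.eventually (by simp)]
      with y hy hy'
    exact fderiv_fun_mul (hy.differentiableAt two_ne_zero) (hy'.differentiableAt two_ne_zero)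
  refine ⟨hf.contDiffAt.mul hg.contDiffAt, by rw [hf.value, hg.value], ?_, ?_⟩
  · rw [← hf.grad, ← hg.grad, ← hf.value, ← hg.value]
    funext i
    simp [ConfSphere.grad, h1.eq_of_nhds]
  · rw [← hf.hess, ← hg.hess, ← hf.grad, ← hg.grad, ← hf.value, ← hg.value]
    ext i j
    have h2 : (fun y => fderiv ℝ (fun x => f x * g x) y (Pi.single j 1)) =ᶠ[𝓝 x₀]
        fun y => f y * fderiv ℝ g y (Pi.single j 1) + g y * fderiv ℝ f y (Pi.single j 1) := by
      filter_upwards [h1] with y hy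
      rw [hy]; rfl
    have hf1 := hf.contDiffAt.differentiableAt two_ne_zero
    have hg1 := hg.contDiffAt.differentiableAt two_ne_zero
    have hf2 := differentiableAt_fderiv_apply hf.contDiffAt (Pi.single j 1)
    have hg2 := differentiableAt_fderiv_apply hg.contDiffAt (Pi.single j 1)
    rw [hess_apply, h2.fderiv_eq, fderiv_fun_add (hf1.fun_mul hg2) (hg1.fun_mul hf2),
      fderiv_fun_mul hf1 hg2, fderiv_fun_mul hg1 hf2]
    simp only [add_apply, smul_apply, smul_eq_mul,
      Matrix.add_apply, Matrix.smul_apply, Matrix.vecMulVec_apply, hess_apply, ConfSphere.grad]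
    ring

theorem const_mul (e : ℝ) (hf : HasTwoJetAt f x₀ c v H) :
    HasTwoJetAt (fun x => e * f x) x₀ (e * c) (e • v) (e • H) := by
  have h := (const (x₀ := x₀) e).mul hf
  convert h using 1
  · simp
  · ext i j; simp

theorem sum {ι : Type*} (s : Finset ι) {f : ι → (Fin n → ℝ) → ℝ} {c : ι → ℝ} {v : ι → Fin n → ℝ}
    {H : ι → Matrix (Fin n) (Fin n) ℝ} (h : ∀ i ∈ s, HasTwoJetAt (f i) x₀ (c i) (v i) (H i)) :
    HasTwoJetAt (fun x => ∑ i ∈ s, f i x) x₀ (∑ i ∈ s, c i) (∑ i ∈ s, v i) (∑ i ∈ s, H i) := by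
  classical
  induction s using Finset.induction_on with
  | empty => simpa using const (x₀ := x₀) 0
  | insert a s ha ih =>
    simp only [Finset.sum_insert ha]
    exact (h a (Finset.mem_insert_self a s)).add
      (ih fun i hi => h i (Finset.mem_insert_of_mem hi))

theorem unique (hf : HasTwoJetAt f x₀ c v H) (hg : HasTwoJetAt g x₀ d w K) (h : f =ᶠ[𝓝 x₀] g) :
    c = d ∧ v = w ∧ H = K :=
  ⟨by rw [← hf.value, ← hg.value, h.eq_of_nhds], by rw [← hf.grad, ← hg.grad, grad_congr h],
    by rw [← hf.hess, ← hg.hess, hess_congr h]⟩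

end HasTwoJetAt

/-- The zero set of a smooth function with non-vanishing `u`-derivative is locally the graph of a
smooth function. -/
theorem exists_implicit_graph {n : ℕ} {Ψ : ℝ × (Fin n → ℝ) → ℝ} (hΨ : ContDiff ℝ ∞ Ψ) {u₀ : ℝ}
    {x₀ : Fin n → ℝ} (h0 : Ψ (u₀, x₀) = 0) (hu : fderiv ℝ Ψ (u₀, x₀) (1, 0) ≠ 0) :
    ∃ f : (Fin n → ℝ) → ℝ, f x₀ = u₀ ∧ (∀ᶠ x in 𝓝 x₀, ContDiffAt ℝ ∞ f x) ∧
      ∀ᶠ y : ℝ × (Fin n → ℝ) in 𝓝 (u₀, x₀), (Ψ y = 0 ↔ y.1 = f y.2) := by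
  set φ : (Fin n → ℝ) × ℝ → ℝ := fun z => Ψ (z.2, z.1) with hφ
  have hφc : ContDiff ℝ ∞ φ := hΨ.comp (contDiff_snd.prodMk contDiff_fst)
  have hinf : (∞ : WithTop ℕ∞) ≠ 0 := by simp
  have hder : ∀ z : (Fin n → ℝ) × ℝ,
      fderiv ℝ φ z (0, 1) = fderiv ℝ Ψ (z.2, z.1) (1, 0) := by
    intro z
    have h1 := (hΨ.differentiable hinf).differentiableAt (x := (z.2, z.1))
    have h2 : HasFDerivAt (fun z : (Fin n → ℝ) × ℝ => (z.2, z.1))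
        ((ContinuousLinearMap.snd ℝ (Fin n → ℝ) ℝ).prod (ContinuousLinearMap.fst ℝ (Fin n → ℝ) ℝ)) z :=
      hasFDerivAt_snd.prodMk hasFDerivAt_fst
    have h3 : HasFDerivAt φ _ z := h1.hasFDerivAt.comp z h2
    rw [h3.fderiv]
    simp
  have hinv : ∀ z : (Fin n → ℝ) × ℝ, fderiv ℝ φ z (0, 1) ≠ 0 →
      (fderiv ℝ φ z ∘L .inr ℝ (Fin n → ℝ) ℝ).IsInvertible := by
    intro z hz
    refine ⟨ContinuousLinearEquiv.unitsEquivAut ℝ (Units.mk0 _ hz), ?_⟩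
    ext
    simp
  set z₀ : (Fin n → ℝ) × ℝ := (x₀, u₀) with hz₀
  have hi0 := hinv z₀ (by rw [hder]; exact hu)
  set f := hφc.contDiffAt.implicitFunction hinf hi0 with hf
  have hf0 : f x₀ = u₀ := hφc.contDiffAt.implicitFunction_apply_self hinf hi0
  have hφ0 : φ z₀ = 0 := h0
  have hfc : ContDiffAt ℝ ∞ f x₀ := hφc.contDiffAt.contDiffAt_implicitFunction hinf hi0
  have hsolve : ∀ᶠ x in 𝓝 x₀, φ (x, f x) = 0 := by
    have := hφc.contDiffAt.eventually_apply_implicitFunction hinf hi0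
    rwa [hφ0] at this
  refine ⟨f, hf0, ?_, ?_⟩
  · have hcont : ∀ᶠ x in 𝓝 x₀, ContDiffAt ℝ 1 f x :=
      (hfc.of_le (by exact_mod_cast le_top)).eventually (by simp)
    have hne : ∀ᶠ x in 𝓝 x₀, fderiv ℝ φ (x, f x) (0, 1) ≠ 0 := by
      have hc : ContinuousAt (fun x => fderiv ℝ φ (x, f x) (0, 1)) x₀ := by
        have h1 : Continuous fun z => fderiv ℝ φ z (0, 1) :=
          (hφc.continuous_fderiv hinf).clm_apply continuous_const
        exact h1.continuousAt.comp (continuousAt_id.prodMk hfc.continuousAt)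
      refine hc.eventually_ne ?_
      rw [hf0, hder]
      exact hu
    -- Smoothness at `x₀` alone gives each finite order only on its own neighbourhood. So the
    -- implicit function theorem is applied again at every nearby `(x, f x)`; by uniqueness its
    -- solution agrees with `f` near `x`.
    filter_upwards [hcont, hne, hsolve.eventually_nhds, hsolve] with x hx hxn hxs hx0
    have hi := hinv (x, f x) hxn
    have hiff := hφc.contDiffAt.eventually_apply_eq_iff_implicitFunction hinf hi
    refine (hφc.contDiffAt.contDiffAt_implicitFunction hinf hi).congr_of_eventuallyEq ?_
    have ht : Tendsto (fun x' => (x', f x')) (𝓝 x) (𝓝 (x, f x)) :=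
      continuousAt_id.prodMk hx.continuousAt
    filter_upwards [ht.eventually hiff, hxs] with x' h1 h2
    exact (h1.1 (by rw [h2, hx0])).symm
  · have hiff := hφc.contDiffAt.eventually_apply_eq_iff_implicitFunction hinf hi0
    have ht : Tendsto (fun y : ℝ × (Fin n → ℝ) => (y.2, y.1)) (𝓝 (u₀, x₀)) (𝓝 z₀) :=
      (continuous_snd.prodMk continuous_fst).continuousAt
    filter_upwards [ht.eventually hiff] with y hy
    rw [hφ0] at hy
    exact hy.trans eq_comm

/-! ### Quadrics in normal form -/

/-- The function `½ ∑ lⱼ (xʲ)²`. -/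
def quadric {n : ℕ} (l : Fin n → ℝ) (x : Fin n → ℝ) : ℝ := (∑ j, l j * x j ^ 2) / 2

theorem contDiff_quadric {n : ℕ} (l : Fin n → ℝ) : ContDiff ℝ ∞ (quadric l) := by
  unfold quadric; fun_prop

@[simp] theorem quadric_zero {n : ℕ} (l : Fin n → ℝ) : quadric l 0 = 0 := by simp [quadric]

namespace HasTwoJetAt
variable {n : ℕ} {f g : (Fin n → ℝ) → ℝ} {x₀ : Fin n → ℝ} {v w : Fin n → ℝ}
  {H K : Matrix (Fin n) (Fin n) ℝ}

theorem mul_of_zero (hf : HasTwoJetAt f x₀ 0 v H) (hg : HasTwoJetAt g x₀ 0 w K) :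
    HasTwoJetAt (fun x => f x * g x) x₀ 0 0 (Matrix.vecMulVec v w + Matrix.vecMulVec w v) := by
  simpa using hf.mul hg

theorem mul_of_zero_of_one (hf : HasTwoJetAt f x₀ 0 v H) (hg : HasTwoJetAt g x₀ 1 w K) :
    HasTwoJetAt (fun x => f x * g x) x₀ 0 v
      (H + Matrix.vecMulVec v w + Matrix.vecMulVec w v) := by
  simpa using hf.mul hg

theorem coord (i : Fin n) : HasTwoJetAt (fun x => x i - x₀ i) x₀ 0 (Pi.single i 1) 0 := by
  have h := linear (x₀ := x₀) (Pi.single i (1 : ℝ))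
  simpa [Pi.single_apply] using h

end HasTwoJetAt

theorem hasTwoJetAt_quadric {n : ℕ} (l : Fin n → ℝ) :
    HasTwoJetAt (quadric l) 0 0 0 (Matrix.diagonal l) := by
  have h := (HasTwoJetAt.sum Finset.univ fun j _ => HasTwoJetAt.const_mul (l j)
    ((HasTwoJetAt.coord (x₀ := (0 : Fin n → ℝ)) j).mul_of_zero
      (HasTwoJetAt.coord (x₀ := (0 : Fin n → ℝ)) j))).const_mul (1 / 2)
  convert h using 1
  · funext x; simp only [quadric, sq, Pi.zero_apply, sub_zero]; ring
  · simp
  · simp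
  · ext i j
    simp only [Matrix.smul_apply, Matrix.sum_apply, Matrix.add_apply, Matrix.vecMulVec_apply,
      Pi.single_apply, smul_eq_mul, Matrix.diagonal_apply]
    by_cases hij : i = j
    · subst hij
      rw [Finset.sum_eq_single i (fun x _ hx => by simp [hx.symm]) (by simp)]
      simp; ring
    · rw [Finset.sum_eq_zero fun x _ => ?_]
      · simp [hij]
      · by_cases hx : i = x
        · subst hx; simp [Ne.symm hij]
        · simp [hx]

/-- The hypersurface `u = ½ ∑ lⱼ (xʲ)²` in the standard coordinates of `b`, with the origin as marked
point. -/
def quadricHypersurface {n : ℕ} (b : Frame n) (l : Fin n → ℝ) : PointedHypersurface n where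
  surf :=
    { carrier := {a | ∃ x, a = b.chart (quadric l x) x}
      isGraph := by
        rintro a ⟨x, rfl⟩
        refine ⟨b, quadric l, x, rfl, Eventually.of_forall fun y => (contDiff_quadric l).contDiffAt,
          Eventually.of_forall fun y => ⟨?_, fun hy => ⟨y.2, by rw [← hy]⟩⟩⟩
        rintro ⟨x', h⟩
        obtain ⟨h1, h2⟩ := b.chart_injective h
        rw [h1, h2] }
  pt := b.chart 0 0
  mem := ⟨0, by rw [quadric_zero]⟩

theorem isGraph_quadricHypersurface {n : ℕ} (b : Frame n) (l : Fin n → ℝ) :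
    (quadricHypersurface b l).IsGraph b (quadric l) 0 := by
  refine ⟨by rw [quadric_zero]; rfl, Eventually.of_forall fun y => (contDiff_quadric l).contDiffAt,
    Eventually.of_forall fun y => ⟨?_, fun hy => ⟨y.2, by rw [← hy]⟩⟩⟩
  rintro ⟨x', h⟩
  obtain ⟨h1, h2⟩ := b.chart_injective h
  rw [h1, h2]

theorem Frame.flip_lift {n : ℕ} (b : Frame n) (j : Fin n) (u : ℝ) (x : Fin n → ℝ) :
    (b.flip j).lift u x = b.lift u fun i => if i = j then -x i else x i := by
  have h2 : ∀ i, (if i = j then -x i else x i) ^ 2 = x i ^ 2 := fun i => by split_ifs <;> ring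
  have h1 : ∀ i, x i • (b.flip j).e i.succ = (if i = j then -x i else x i) • b.e i.succ := by
    intro i
    by_cases h : i = j <;> simp [Frame.flip, h]
  have h0 : (b.flip j).e 0 = b.e 0 := by simp [Frame.flip, (Fin.succ_ne_zero _).symm]
  simp only [Frame.lift, h1, h2, h0]
  rfl

theorem Frame.flip_chart {n : ℕ} (b : Frame n) (j : Fin n) (u : ℝ) (x : Fin n → ℝ) :
    (b.flip j).chart u x = b.chart u fun i => if i = j then -x i else x i := by
  apply Subtype.ext
  simp only [Frame.chart, Frame.flip_lift]

/-- A quadric in normal form is even in each coordinate, so it has the same equation after a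
reflection. This makes up for the restriction to determinant one. -/
theorem isGraph_flip_quadricHypersurface {n : ℕ} (b : Frame n) (j : Fin n) (l : Fin n → ℝ) :
    (quadricHypersurface b l).IsGraph (b.flip j) (quadric l) 0 := by
  have hq : ∀ x : Fin n → ℝ, quadric l (fun i => if i = j then -x i else x i) = quadric l x := by
    intro x
    have h2 : ∀ i, (if i = j then -x i else x i) ^ 2 = x i ^ 2 := fun i => by split_ifs <;> ring
    simp only [quadric, h2]
  refine ⟨?_, Eventually.of_forall fun y => (contDiff_quadric l).contDiffAt,
    Eventually.of_forall fun y => ?_⟩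
  · rw [quadric_zero, Frame.flip_chart]
    simp only [Pi.zero_apply, neg_zero, ite_self]
    rfl
  · rw [Frame.flip_chart]
    constructor
    · rintro ⟨x', h⟩
      obtain ⟨h1, h2⟩ := b.chart_injective h
      rw [h1, ← h2, hq]
    · intro h
      exact ⟨_, by rw [hq, h]⟩

/-- Membership of a quadric in normal form in an invariant equation does not depend on the standard
coordinates. -/
theorem jet_quadricHypersurface_mem_iff {n : ℕ} (hn : 1 ≤ n) {E : Set (J2 n)} (hE : IsInvariant E)
    (b b' : Frame n) (l : Fin n → ℝ) :
    jet (quadricHypersurface b l) ∈ E ↔ jet (quadricHypersurface b' l) ∈ E := by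
  suffices h : ∀ b b' : Frame n,
      jet (quadricHypersurface b l) ∈ E → jet (quadricHypersurface b' l) ∈ E from ⟨h b b', h b' b⟩
  intro b b' hb
  obtain ⟨g, hg⟩ := b.exists_act_eq b' ⟨0, hn⟩
  have h1 : J2.act g (jet (quadricHypersurface b l)) ∈ E := by
    rw [← hE g]; exact ⟨_, hb, rfl⟩
  have h2 : jet ((quadricHypersurface b l).act g) = jet (quadricHypersurface b' l) := by
    refine Quot.sound ⟨b.act g, quadric l, quadric l, 0, (isGraph_quadricHypersurface b l).act g,
      ?_, rfl, rfl, rfl⟩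
    rcases hg with hg | hg
    · rw [hg]; exact isGraph_quadricHypersurface b' l
    · rw [hg]; exact isGraph_flip_quadricHypersurface b' _ l
  rw [← h2]
  exact h1

/-! ### Adapted standard bases -/

namespace Frame
variable {n : ℕ} (b : Frame n)

/-- The standard basis whose coordinates are those of `b` translated to the origin `(u₀, x₀)`. -/
def translate (u₀ : ℝ) (x₀ : Fin n → ℝ) : Frame n where
  p := b.lift u₀ x₀
  q := b.q
  e i := b.e i - (Fin.cons u₀ x₀ : Fin (n + 1) → ℝ) i • b.q
  pp := b.mink_lift u₀ x₀
  qq := b.qq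
  pq := b.mink_lift_q u₀ x₀
  pe i := by
    refine Fin.cases ?_ (fun i => ?_) i <;>
    simp [mink_lift_q, mink_lift_e_zero, mink_lift_e_succ]
  qe i := by simp [b.qe, b.qq]
  ee i j := by simp [b.qe, b.ee, b.mink_e_q, b.qq]

/-- The standard basis in which the orthonormal vectors are rotated. -/
def rotate (N : Fin (n + 1) → Fin (n + 1) → ℝ)
    (hN : ∀ i j, ∑ k, N i k * N j k = if i = j then 1 else 0) : Frame n where
  p := b.p
  q := b.q
  e i := ∑ k, N i k • b.e k
  pp := b.pp
  qq := b.qq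
  pq := b.pq
  pe i := by simp [b.pe]
  qe i := by simp [b.qe]
  ee i j := by rw [← hN i j]; simp [b.ee, mul_comm]

/-- The standard basis in which the hyperplane through `p` orthogonal to `e₀` is replaced by a tangent
sphere. -/
def tilt (c : ℝ) : Frame n where
  p := b.p
  q := b.q + c • b.e 0 - (c ^ 2 / 2) • b.p
  e i := b.e i - (if i = 0 then c else 0) • b.p
  pp := b.pp
  qq := by
    simp [b.pp, b.qq, b.pq, b.pe, b.qe, b.ee, b.mink_e_p, b.mink_e_q, b.mink_q_p]; ring
  pq := by simp [b.pp, b.pq, b.pe]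
  pe i := by rw [map_sub, map_smul, b.pp, b.pe, smul_zero, sub_zero]
  qe i := by
    by_cases h : i = 0
    · simp [h, b.pp, b.pe, b.qe, b.ee, b.mink_e_p, b.mink_q_p]
    · simp [h, b.pe, b.qe, b.ee, Ne.symm h]
  ee i j := by
    simp only [map_sub, map_smul, LinearMap.sub_apply, LinearMap.smul_apply, b.pp, b.pe, b.ee, b.mink_e_p,
      smul_zero, sub_zero]

/-- The standard basis whose coordinates are scaled by `s`. -/
def scale (s : ℝ) (hs : s ≠ 0) : Frame n where
  p := s • b.p
  q := s⁻¹ • b.q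
  e := b.e
  pp := by simp [b.pp]
  qq := by simp [b.qq]
  pq := by simp [b.pq, hs]
  pe i := by simp [b.pe]
  qe i := by simp [b.qe]
  ee := b.ee

end Frame

/-- The equation, in standard coordinates, of the quadric in normal form with respect to the adapted
standard basis: `δ` and `h` are the coordinates relative to the base point, `ν (1, -v)` is the unit
normal there and the columns of `K` are the `x`-components of an orthonormal tangent basis. -/
def adaptedEquation {n : ℕ} (u₀ : ℝ) (x₀ : Fin n → ℝ) (ν : ℝ) (v : Fin n → ℝ)
    (K : Matrix (Fin n) (Fin n) ℝ) (c s : ℝ) (l : Fin n → ℝ) (u : ℝ) (x : Fin n → ℝ) : ℝ :=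
  -- With `m`, `a`, `rⱼ` the products of the lift with the adapted `q`, `e₀`, `eⱼ`, the adapted
  -- coordinates are `a / m` and `rⱼ / m`. Clearing denominators in the quadric leaves `a m - ½ ∑ lⱼ
  -- rⱼ² = 0`.
  s⁻¹ * (((ν * (u - u₀) + ∑ i, (-ν * v i) * (x i - x₀ i)) +
      c / 2 * ((u - u₀) * (u - u₀) + ∑ i, (x i - x₀ i) * (x i - x₀ i))) *
    (1 + (c * (ν * (u - u₀) + ∑ i, (-ν * v i) * (x i - x₀ i)) +
      c ^ 2 / 4 * ((u - u₀) * (u - u₀) + ∑ i, (x i - x₀ i) * (x i - x₀ i))))) +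
  (-1 / 2) * ∑ j, l j *
    (((∑ k, v k * K k j) * (u - u₀) + ∑ k, K k j * (x k - x₀ k)) *
     ((∑ k, v k * K k j) * (u - u₀) + ∑ k, K k j * (x k - x₀ k)))

theorem contDiff_adaptedEquation {n : ℕ} (u₀ : ℝ) (x₀ : Fin n → ℝ) (ν : ℝ) (v : Fin n → ℝ)
    (K : Matrix (Fin n) (Fin n) ℝ) (c s : ℝ) (l : Fin n → ℝ) :
    ContDiff ℝ ∞ fun y : ℝ × (Fin n → ℝ) => adaptedEquation u₀ x₀ ν v K c s l y.1 y.2 := by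
  unfold adaptedEquation
  fun_prop

theorem fderiv_adaptedEquation {n : ℕ} (u₀ : ℝ) (x₀ : Fin n → ℝ) (ν : ℝ) (v : Fin n → ℝ)
    (K : Matrix (Fin n) (Fin n) ℝ) (c s : ℝ) (l : Fin n → ℝ) :
    fderiv ℝ (fun y : ℝ × (Fin n → ℝ) => adaptedEquation u₀ x₀ ν v K c s l y.1 y.2) (u₀, x₀) (1, 0)
      = s⁻¹ * ν := by
  have h1 := (((contDiff_adaptedEquation u₀ x₀ ν v K c s l).differentiable (by simp))
    (u₀, x₀)).hasFDerivAt
  have h2 : HasDerivAt (fun u : ℝ => (u, x₀)) ((1 : ℝ), (0 : Fin n → ℝ)) u₀ :=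
    (hasDerivAt_id u₀).prodMk (hasDerivAt_const _ _)
  have h3 := h1.comp_hasDerivAt u₀ h2
  have h4 : HasDerivAt (fun u => adaptedEquation u₀ x₀ ν v K c s l u x₀) (s⁻¹ * ν) u₀ := by
    have hd : HasDerivAt (fun u : ℝ => u - u₀) 1 u₀ := (hasDerivAt_id u₀).sub_const u₀
    set m : ℝ := ∑ j, l j * ((∑ k, v k * K k j) * (∑ k, v k * K k j)) with hm
    -- With the factor `u - u₀` split off, the derivative at `u₀` is the value of the cofactor
    -- there.
    have e : (fun u => adaptedEquation u₀ x₀ ν v K c s l u x₀) = fun u =>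
        (u - u₀) * (s⁻¹ * ((ν + c / 2 * (u - u₀)) * (1 + (c * (ν * (u - u₀)) +
          c ^ 2 / 4 * ((u - u₀) * (u - u₀))))) - 1 / 2 * m * (u - u₀)) := by
      funext u
      simp only [adaptedEquation, sub_self, mul_zero, Finset.sum_const_zero, add_zero]
      have : ∑ j, l j * ((∑ k, v k * K k j) * (u - u₀) * ((∑ k, v k * K k j) * (u - u₀)))
          = m * ((u - u₀) * (u - u₀)) := by
        rw [hm, Finset.sum_mul]
        exact Finset.sum_congr rfl fun j _ => by ring
      rw [this]
      ring
    rw [e]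
    have hg : DifferentiableAt ℝ (fun u => s⁻¹ * ((ν + c / 2 * (u - u₀)) * (1 + (c * (ν * (u - u₀)) +
          c ^ 2 / 4 * ((u - u₀) * (u - u₀))))) - 1 / 2 * m * (u - u₀)) u₀ := by fun_prop
    have h5 := hd.mul hg.hasDerivAt
    refine h5.congr_deriv ?_
    simp
  exact h3.unique h4

/-- A function solving the adapted equation has the prescribed two-jet. -/
theorem grad_hess_of_adaptedEquation {n : ℕ} {f : (Fin n → ℝ) → ℝ} {x₀ : Fin n → ℝ} {ν : ℝ}
    {v : Fin n → ℝ} {K : Matrix (Fin n) (Fin n) ℝ} {c s : ℝ} {l : Fin n → ℝ} (hν : ν ≠ 0)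
    (hs : s ≠ 0) (hf : ContDiffAt ℝ 2 f x₀)
    (h : ∀ᶠ x in 𝓝 x₀, adaptedEquation (f x₀) x₀ ν v K c s l (f x) x = 0) :
    grad f x₀ = v ∧ ν • hess f x₀ + c • (1 + Matrix.vecMulVec v v) =
      s • ((1 + Matrix.vecMulVec v v) * K * Matrix.diagonal l * K.transpose
        * (1 + Matrix.vecMulVec v v)) := by
  have hδ : HasTwoJetAt (fun x => f x - f x₀) x₀ 0 (grad f x₀) (hess f x₀) := by
    simpa [sub_eq_add_neg] using
      (HasTwoJetAt.of_contDiffAt hf).add (HasTwoJetAt.const (x₀ := x₀) (-f x₀))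
  set w := grad f x₀ with hw
  set H := hess f x₀ with hH
  have ha : HasTwoJetAt (fun x => ν * (f x - f x₀) + ∑ i, (-ν * v i) * (x i - x₀ i)) x₀ 0
      (ν • w - ν • v) (ν • H) := by
    convert (hδ.const_mul ν).add (HasTwoJetAt.linear (x₀ := x₀) fun i => -ν * v i) using 1
    · simp
    · funext i; simp [sub_eq_add_neg]
    · simp
  have hQ : HasTwoJetAt (fun x => (f x - f x₀) * (f x - f x₀) +
      ∑ i, (x i - x₀ i) * (x i - x₀ i)) x₀ 0 0 ((2 : ℝ) • (1 + Matrix.vecMulVec w w)) := by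
    convert (hδ.mul_of_zero hδ).add (HasTwoJetAt.sum Finset.univ fun i _ =>
      (HasTwoJetAt.coord (x₀ := x₀) i).mul_of_zero (HasTwoJetAt.coord (x₀ := x₀) i)) using 1
    · simp
    · simp
    · have : ∑ i : Fin n, (Matrix.vecMulVec (Pi.single i (1 : ℝ)) (Pi.single i 1) +
          Matrix.vecMulVec (Pi.single i (1 : ℝ)) (Pi.single i 1)) =
          (2 : ℝ) • (1 : Matrix (Fin n) (Fin n) ℝ) := by
        ext i j
        simp only [Matrix.sum_apply, Matrix.add_apply, Matrix.vecMulVec_apply, Pi.single_apply,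
          Matrix.smul_apply, Matrix.one_apply, smul_eq_mul]
        by_cases hij : i = j
        · subst hij
          rw [Finset.sum_eq_single i (fun x _ hx => by simp [hx.symm]) (by simp)]
          simp; norm_num
        · rw [Finset.sum_eq_zero fun x _ => ?_]
          · simp [hij]
          · by_cases hx : i = x
            · subst hx; simp [Ne.symm hij]
            · simp [hx]
      rw [this, smul_add, two_smul ℝ (Matrix.vecMulVec w w), add_comm]
  have hL := ha.add (hQ.const_mul (c / 2))
  have hM := (HasTwoJetAt.const (x₀ := x₀) 1).add ((ha.const_mul c).add (hQ.const_mul (c ^ 2 / 4)))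
  simp only [mul_zero, add_zero, smul_zero, zero_add] at hL hM
  have hl := fun j => (hδ.const_mul (∑ k, v k * K k j)).add
    (HasTwoJetAt.linear (x₀ := x₀) fun k => K k j)
  simp only [mul_zero, add_zero] at hl
  have hR := HasTwoJetAt.sum Finset.univ fun j _ => ((hl j).mul_of_zero (hl j)).const_mul (l j)
  have hall := ((hL.mul_of_zero_of_one hM).const_mul s⁻¹).add (hR.const_mul (-1 / 2))
  -- The left side of the equation, as a function of `x`, has zero 2-jet: order one forces the
  -- gradient to be `v`, order two gives the Hessian.
  obtain ⟨-, h1, h2⟩ := hall.unique (HasTwoJetAt.const (x₀ := x₀) 0) h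
  have hwv : w = v := by
    simp only [smul_zero, Finset.sum_const_zero, add_zero, ← smul_sub, smul_eq_zero, inv_eq_zero, hs,
      hν, false_or, sub_eq_zero] at h1
    exact h1
  refine ⟨hwv, ?_⟩
  rw [hwv] at h2
  simp only [sub_self, smul_zero, Matrix.vecMulVec_zero, add_zero] at h2
  -- The gradient of the `j`-th tangential coordinate along the graph is the `j`-th column of `(1 +
  -- v vᵀ) K`.
  have hcol : ∀ i j, ((1 + Matrix.vecMulVec v v) * K) i j = (∑ k, v k * K k j) * v i + K i j := by
    intro i j
    rw [add_mul, one_mul, Matrix.add_apply, Matrix.mul_apply, Finset.sum_mul, add_comm]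
    congr 1
    exact Finset.sum_congr rfl fun k _ => by rw [Matrix.vecMulVec_apply]; ring
  have hsym : K.transpose * (1 + Matrix.vecMulVec v v) =
      ((1 + Matrix.vecMulVec v v) * K).transpose := by
    rw [Matrix.transpose_mul, Matrix.transpose_add, Matrix.transpose_one,
      Matrix.transpose_vecMulVec]
  rw [Matrix.mul_assoc _ K.transpose, hsym]
  ext i j
  have h3 := congrFun (congrFun h2 i) j
  simp only [Matrix.add_apply, Matrix.smul_apply, Matrix.sum_apply, Matrix.vecMulVec_apply,
    smul_eq_mul, Pi.add_apply, Pi.smul_apply, Matrix.zero_apply] at h3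
  rw [Matrix.smul_apply, Matrix.mul_apply]
  simp only [Matrix.mul_diagonal, Matrix.transpose_apply, hcol, Matrix.add_apply, Matrix.smul_apply,
    smul_eq_mul, Matrix.vecMulVec_apply]
  have h4 : ∑ x, l x * ((((∑ k, v k * K k x) * v i + K i x) * ((∑ k, v k * K k x) * v j + K j x)) +
      ((∑ k, v k * K k x) * v i + K i x) * ((∑ k, v k * K k x) * v j + K j x)) =
      2 * ∑ x, ((∑ k, v k * K k x) * v i + K i x) * l x * ((∑ k, v k * K k x) * v j + K j x) := by
    rw [Finset.mul_sum]
    exact Finset.sum_congr rfl fun x _ => by ring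
  rw [h4] at h3
  generalize ∑ x, ((∑ k, v k * K k x) * v i + K i x) * l x *
    ((∑ k, v k * K k x) * v j + K j x) = T at h3 ⊢
  field_simp at h3
  linarith

/-! ### Transition to adapted coordinates -/

/-- The components of the unit normal `ν (1, -v)` and of the tangent vectors `(v · a, a)`, for `a` the
columns of `K`. -/
def adaptedRotation {n : ℕ} (ν : ℝ) (v : Fin n → ℝ) (K : Matrix (Fin n) (Fin n) ℝ) :
    Fin (n + 1) → Fin (n + 1) → ℝ :=
  Fin.cons (Fin.cons ν fun i => -ν * v i) fun j => Fin.cons (∑ k, v k * K k j) fun k => K k j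

/-- The Euclidean product of tangent vectors `(v · a, a)` and `(v · a', a')` is `aᵀ (1 + v vᵀ) a'`,
and `(1, -v)` is orthogonal to all of them. -/
theorem adaptedRotation_orthonormal {n : ℕ} {ν : ℝ} {v : Fin n → ℝ} {K : Matrix (Fin n) (Fin n) ℝ}
    (hν : ν ^ 2 * (1 + ∑ k, v k ^ 2) = 1)
    (hK : K.transpose * (1 + Matrix.vecMulVec v v) * K = 1) (i j : Fin (n + 1)) :
    ∑ k, adaptedRotation ν v K i k * adaptedRotation ν v K j k = if i = j then 1 else 0 := by
  have h01 : ∀ j, ν * ∑ k, v k * K k j + ∑ k, -ν * v k * K k j = 0 := by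
    intro j
    rw [Finset.mul_sum, ← Finset.sum_add_distrib]
    exact Finset.sum_eq_zero fun k _ => by ring
  refine Fin.cases ?_ (fun i => ?_) i <;> refine Fin.cases ?_ (fun j => ?_) j
  · simp only [adaptedRotation, Fin.sum_univ_succ, Fin.cons_zero, Fin.cons_succ, if_true]
    rw [← hν, mul_add, Finset.mul_sum]
    congr 1
    · ring
    · exact Finset.sum_congr rfl fun k _ => by ring
  · simp only [adaptedRotation, Fin.sum_univ_succ, Fin.cons_zero, Fin.cons_succ,
      (Fin.succ_ne_zero _).symm, if_false]
    exact h01 j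
  · simp only [adaptedRotation, Fin.sum_univ_succ, Fin.cons_zero, Fin.cons_succ,
      Fin.succ_ne_zero, if_false]
    rw [← h01 i, mul_comm]
    congr 1
    exact Finset.sum_congr rfl fun k _ => mul_comm _ _
  · simp only [adaptedRotation, Fin.sum_univ_succ, Fin.cons_zero, Fin.cons_succ, Fin.succ_inj]
    rw [← Matrix.one_apply, ← hK, mul_add, mul_one, add_mul, Matrix.add_apply, Matrix.mul_vecMulVec,
      Matrix.vecMulVec_mul, Matrix.vecMulVec_apply, Matrix.mul_apply, add_comm]
    simp only [Matrix.transpose_apply, Matrix.mulVec, Matrix.vecMul, dotProduct]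
    congr 2
    exact Finset.sum_congr rfl fun k _ => mul_comm _ _

/-- The translated `p` is itself a lift, so this product is the source of the terms in the squared
distance in the adapted coordinates. -/
theorem Frame.mink_lift_lift {n : ℕ} (b : Frame n) (u u₀ : ℝ) (x x₀ : Fin n → ℝ) :
    mink n (b.lift u x) (b.lift u₀ x₀) =
      -(1 / 2) * ((u - u₀) * (u - u₀) + ∑ i, (x i - x₀ i) * (x i - x₀ i)) := by
  have e : ∑ i, (x i - x₀ i) * (x i - x₀ i) =
      ∑ i, x i ^ 2 + ∑ i, x₀ i ^ 2 - 2 * ∑ i, x₀ i * x i := by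
    rw [Finset.mul_sum, ← Finset.sum_add_distrib, ← Finset.sum_sub_distrib]
    exact Finset.sum_congr rfl fun i _ => by ring
  conv_lhs => rw [Frame.lift.eq_def b u₀ x₀]
  simp only [map_add, map_sub, map_sum, map_smul, smul_eq_mul, b.mink_lift_p, b.mink_lift_e_zero,
    b.mink_lift_e_succ, b.mink_lift_q]
  rw [e]
  ring

section
variable {n : ℕ} (b : Frame n) (u₀ : ℝ) (x₀ : Fin n → ℝ) {ν : ℝ} {v : Fin n → ℝ}
  {K : Matrix (Fin n) (Fin n) ℝ} (c : ℝ) {s : ℝ}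
  (hν : ν ^ 2 * (1 + ∑ k, v k ^ 2) = 1)
  (hK : K.transpose * (1 + Matrix.vecMulVec v v) * K = 1) (hs : s ≠ 0)

/-- The standard basis with origin `(u₀, x₀)` whose coordinate hyperplane `u = 0` is there a sphere of
curvature `-c` with unit normal `ν (1, -v)`. -/
def Frame.adapted : Frame n :=
  (((b.translate u₀ x₀).rotate (adaptedRotation ν v K) (adaptedRotation_orthonormal hν hK)).tilt
    c).scale s hs

theorem Frame.mink_lift_adapted_q (u : ℝ) (x : Fin n → ℝ) :
    mink n (b.lift u x) (b.adapted u₀ x₀ c hν hK hs).q =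
      s⁻¹ * (1 + (c * (ν * (u - u₀) + ∑ i, (-ν * v i) * (x i - x₀ i)) +
      c ^ 2 / 4 * ((u - u₀) * (u - u₀) + ∑ i, (x i - x₀ i) * (x i - x₀ i)))) := by
  simp only [adapted, scale, tilt, rotate, translate, adaptedRotation, Fin.sum_univ_succ,
    Fin.cons_zero, Fin.cons_succ, map_add, map_sub, map_sum, map_smul, smul_eq_mul,
    b.mink_lift_e_zero, b.mink_lift_e_succ, b.mink_lift_q, mul_one, b.mink_lift_lift]
  ring

theorem Frame.mink_lift_adapted_e_zero (u : ℝ) (x : Fin n → ℝ) :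
    mink n (b.lift u x) ((b.adapted u₀ x₀ c hν hK hs).e 0) =
      (ν * (u - u₀) + ∑ i, (-ν * v i) * (x i - x₀ i)) +
      c / 2 * ((u - u₀) * (u - u₀) + ∑ i, (x i - x₀ i) * (x i - x₀ i)) := by
  simp only [adapted, scale, tilt, rotate, translate, adaptedRotation, Fin.sum_univ_succ,
    Fin.cons_zero, Fin.cons_succ, map_add, map_sub, map_sum, map_smul, smul_eq_mul, if_true,
    b.mink_lift_e_zero, b.mink_lift_e_succ, b.mink_lift_q, mul_one, b.mink_lift_lift]
  ring

theorem Frame.mink_lift_adapted_e_succ (u : ℝ) (x : Fin n → ℝ) (j : Fin n) :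
    mink n (b.lift u x) ((b.adapted u₀ x₀ c hν hK hs).e j.succ) =
      (∑ k, v k * K k j) * (u - u₀) + ∑ k, K k j * (x k - x₀ k) := by
  simp only [adapted, scale, tilt, rotate, translate, adaptedRotation, Fin.sum_univ_succ,
    Fin.cons_zero, Fin.cons_succ, map_add, map_sub, map_sum, map_smul, smul_eq_mul,
    Fin.succ_ne_zero, if_false, zero_smul, sub_zero, b.mink_lift_e_zero, b.mink_lift_e_succ,
    b.mink_lift_q, mul_one]

/-- Multiplying the equation of the quadric by the square of the product with the adapted `q` is
reversible exactly where that product is nonzero, that is, where the adapted coordinates are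
defined. -/
theorem chart_mem_quadricHypersurface_iff (l : Fin n → ℝ) {u : ℝ} {x : Fin n → ℝ}
    (h : mink n (b.lift u x) (b.adapted u₀ x₀ c hν hK hs).q ≠ 0) :
    b.chart u x ∈ (quadricHypersurface (b.adapted u₀ x₀ c hν hK hs) l).surf.carrier ↔
      adaptedEquation u₀ x₀ ν v K c s l u x = 0 := by
  have hE : adaptedEquation u₀ x₀ ν v K c s l u x =
      mink n (b.lift u x) ((b.adapted u₀ x₀ c hν hK hs).e 0) *
        mink n (b.lift u x) (b.adapted u₀ x₀ c hν hK hs).q -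
      1 / 2 * ∑ j, l j * (mink n (b.lift u x) ((b.adapted u₀ x₀ c hν hK hs).e j.succ) *
        mink n (b.lift u x) ((b.adapted u₀ x₀ c hν hK hs).e j.succ)) := by
    simp only [Frame.mink_lift_adapted_q, Frame.mink_lift_adapted_e_zero,
      Frame.mink_lift_adapted_e_succ, adaptedEquation]
    ring
  rw [hE]
  change (∃ y, b.chart u x = (b.adapted u₀ x₀ c hν hK hs).chart (quadric l y) y) ↔ _
  simp only [Frame.chart_eq_chart_iff]
  set m := mink n (b.lift u x) (b.adapted u₀ x₀ c hν hK hs).q with hm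
  have hquad : ∀ y : Fin n → ℝ,
      (∀ i, mink n (b.lift u x) ((b.adapted u₀ x₀ c hν hK hs).e i.succ) = m * y i) →
      1 / 2 * ∑ j, l j * (mink n (b.lift u x) ((b.adapted u₀ x₀ c hν hK hs).e j.succ) *
        mink n (b.lift u x) ((b.adapted u₀ x₀ c hν hK hs).e j.succ)) = m * (m * quadric l y) := by
    intro y hy
    simp only [hy, quadric]
    rw [Finset.sum_congr rfl fun j _ =>
      (show l j * (m * y j * (m * y j)) = m * m * (l j * y j ^ 2) by ring), ← Finset.mul_sum]
    ring
  constructor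
  · rintro ⟨y, -, h0, hy⟩
    rw [hquad y hy, h0]
    ring
  · intro h0
    have hy : ∀ i : Fin n, mink n (b.lift u x) ((b.adapted u₀ x₀ c hν hK hs).e i.succ) =
        m * (mink n (b.lift u x) ((b.adapted u₀ x₀ c hν hK hs).e i.succ) / m) :=
      fun i => (mul_div_cancel₀ _ h).symm
    refine ⟨fun i => mink n (b.lift u x) ((b.adapted u₀ x₀ c hν hK hs).e i.succ) / m, h, ?_, hy⟩
    rw [hquad _ hy, sub_eq_zero, mul_comm] at h0
    exact mul_left_cancel₀ h h0

end

/-- A hypersurface has at each point the two-jet of a quadric in normal form: after subtracting a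
multiple of the first fundamental form, the second fundamental form is to be diagonalized. -/
theorem PointedHypersurface.IsGraph.exists_jet_eq {n : ℕ} {P : PointedHypersurface n} {b : Frame n}
    {f : (Fin n → ℝ) → ℝ} {x₀ : Fin n → ℝ} (hP : P.IsGraph b f x₀)
    {K : Matrix (Fin n) (Fin n) ℝ} {c s : ℝ} {l : Fin n → ℝ} (hs : s ≠ 0)
    (hK : K.transpose * firstForm f x₀ * K = 1)
    (hl : K.transpose * (secondForm f x₀ + c • firstForm f x₀) * K = s • Matrix.diagonal l) :
    ∃ b' : Frame n, jet P = jet (quadricHypersurface b' l) := by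
  set v := grad f x₀ with hv
  set ν := (Real.sqrt (1 + ∑ k, v k ^ 2))⁻¹ with hνdef
  have hpos : 0 < 1 + ∑ k, v k ^ 2 := by positivity
  have hν0 : ν ≠ 0 := inv_ne_zero (Real.sqrt_pos.2 hpos).ne'
  have hν : ν ^ 2 * (1 + ∑ k, v k ^ 2) = 1 := by
    rw [hνdef, inv_pow, Real.sq_sqrt hpos.le, inv_mul_cancel₀ hpos.ne']
  have hK' : K.transpose * (1 + Matrix.vecMulVec v v) * K = 1 := hK
  set b' := b.adapted (f x₀) x₀ c hν hK' hs with hb'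
  have hΨc := contDiff_adaptedEquation (f x₀) x₀ ν v K c s l
  have hbase : mink n (b.lift (f x₀) x₀) b'.q = s⁻¹ := by
    rw [hb', Frame.mink_lift_adapted_q]; simp
  obtain ⟨φ, hφ0, hφc, hφ⟩ := exists_implicit_graph (x₀ := x₀) (u₀ := f x₀) hΨc
    (by simp [adaptedEquation])
    (by rw [fderiv_adaptedEquation]; exact mul_ne_zero (inv_ne_zero hs) hν0)
  have hφ2 : ContDiffAt ℝ 2 φ x₀ := by exact_mod_cast contDiffAt_infty.1 hφc.self_of_nhds 2
  have hgraph : (quadricHypersurface b' l).IsGraph b φ x₀ := by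
    refine ⟨?_, hφc, ?_⟩
    · change b'.chart 0 0 = _
      rw [eq_comm, Frame.chart_eq_chart_iff, hφ0, hbase]
      refine ⟨inv_ne_zero hs, ?_, fun i => ?_⟩
      · rw [hb', Frame.mink_lift_adapted_e_zero]; simp
      · rw [hb', Frame.mink_lift_adapted_e_succ]; simp
    · have hne : ∀ᶠ y : ℝ × (Fin n → ℝ) in 𝓝 (f x₀, x₀), mink n (b.lift y.1 y.2) b'.q ≠ 0 := by
        have hc : Continuous fun y : ℝ × (Fin n → ℝ) => mink n (b.lift y.1 y.2) b'.q := by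
          simp only [hb', Frame.mink_lift_adapted_q]
          fun_prop
        refine hc.continuousAt.eventually_ne ?_
        rw [hbase]
        exact inv_ne_zero hs
      rw [hφ0]
      filter_upwards [hφ, hne] with y h1 h2
      rw [chart_mem_quadricHypersurface_iff b (f x₀) x₀ c hν hK' hs l h2]
      exact h1
  have hsol : ∀ᶠ x in 𝓝 x₀, adaptedEquation (φ x₀) x₀ ν v K c s l (φ x) x = 0 := by
    have ht : Tendsto (fun x => (φ x, x)) (𝓝 x₀) (𝓝 (f x₀, x₀)) := by
      have := hφ2.continuousAt.prodMk (continuousAt_id (x := x₀))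
      rw [ContinuousAt, hφ0] at this
      exact this
    filter_upwards [ht.eventually hφ] with x hx
    rw [hφ0]
    exact hx.2 rfl
  obtain ⟨hgrad, hhess⟩ := grad_hess_of_adaptedEquation hν0 hs hφ2 hsol
  refine ⟨b', Quot.sound ⟨b, f, φ, x₀, hP, hgraph, hφ0.symm, hgrad.symm, ?_⟩⟩
  set g := 1 + Matrix.vecMulVec v v with hg
  have hgt : g.transpose = g := by
    rw [hg, Matrix.transpose_add, Matrix.transpose_one, Matrix.transpose_vecMulVec]
  -- A one-sided inverse of a square matrix is two-sided, so `Kᵀ g K = 1` also gives `g K Kᵀ = 1`;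
  -- together these undo the diagonalization `hl`.
  have h1 : K * (K.transpose * g) = 1 := mul_eq_one_comm.1 hK'
  have h2 : g * K * K.transpose = 1 := by
    have := congrArg Matrix.transpose h1
    rwa [Matrix.transpose_mul, Matrix.transpose_mul, Matrix.transpose_transpose,
      Matrix.transpose_one, hgt] at this
  have h3 : s • (g * K * Matrix.diagonal l * K.transpose * g) = ν • hess f x₀ + c • g := by
    calc s • (g * K * Matrix.diagonal l * K.transpose * g)
        = g * K * (s • Matrix.diagonal l) * K.transpose * g := by
          simp only [Matrix.mul_smul, Matrix.smul_mul]
      _ = (g * K * K.transpose) * (ν • hess f x₀ + c • g) * (K * (K.transpose * g)) := by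
          rw [← hl]
          simp only [Matrix.mul_assoc]
          rfl
      _ = _ := by rw [h1, h2, one_mul, mul_one]
  rw [h3] at hhess
  exact (smul_right_injective _ hν0 (add_right_cancel hhess)).symm

/-! ### Principal curvatures -/

/-- The first fundamental form of a graph has an orthonormal basis. -/
theorem exists_firstForm_orthonormal {n : ℕ} (f : (Fin n → ℝ) → ℝ) (x : Fin n → ℝ) :
    ∃ K : Matrix (Fin n) (Fin n) ℝ, K.transpose * firstForm f x * K = 1 := by
  set v := grad f x with hv
  set V := Matrix.vecMulVec v v with hV
  set r := ∑ k, v k ^ 2 with hr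
  set ν := (Real.sqrt (1 + r))⁻¹ with hν
  have hpos : 0 < 1 + r := by positivity
  have hν0 : 0 < ν := inv_pos.2 (Real.sqrt_pos.2 hpos)
  have hν2 : ν ^ 2 * (1 + r) = 1 := by
    rw [hν, inv_pow, Real.sq_sqrt hpos.le, inv_mul_cancel₀ hpos.ne']
  have hVV : V * V = r • V := by
    rw [hV, Matrix.vecMulVec_mul_vecMulVec]
    ext i j
    simp only [Matrix.vecMulVec_apply, Matrix.smul_apply, smul_eq_mul, dotProduct, Pi.smul_apply, hr, sq]
    ring
  have hVt : V.transpose = V := Matrix.transpose_vecMulVec v v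
  obtain ⟨a, ha⟩ : ∃ a : ℝ, 1 + (1 + r) * (-2 * a + a ^ 2 * r) = 0 := by
    -- The matrix `1 - a V` is to be `(1 + V)^(-1/2)`, with eigenvalue `1 - a r = ν` on `v`. Writing
    -- `(1 - ν) / r` as `ν² / (1 + ν)` also covers `r = 0`.
    refine ⟨ν ^ 2 / (1 + ν), ?_⟩
    have h1 : 1 + ν ≠ 0 := by positivity
    have h2 : r = 1 / ν ^ 2 - 1 := by
      have := hν0.ne'
      field_simp
      linarith
    have h3 := hν0.ne'
    rw [h2]
    field_simp
    ring
  refine ⟨1 - a • V, ?_⟩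
  have e : (1 - a • V) * (1 + V) * (1 - a • V) =
      1 + (1 + (1 + r) * (-2 * a + a ^ 2 * r)) • V := by
    simp only [mul_add, add_mul, mul_sub, sub_mul, one_mul, mul_one, Matrix.smul_mul, Matrix.mul_smul,
      hVV, smul_smul]
    module
  rw [Matrix.transpose_sub, Matrix.transpose_one, Matrix.transpose_smul, hVt]
  change (1 - a • V) * (1 + V) * (1 - a • V) = 1
  rw [e, ha, zero_smul, add_zero]

/-- Simultaneous diagonalization of the fundamental forms: principal directions and principal
curvatures. -/
theorem exists_principal_basis {n : ℕ} {f : (Fin n → ℝ) → ℝ} {x : Fin n → ℝ}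
    (hf : ContDiffAt ℝ 2 f x) :
    ∃ (K : Matrix (Fin n) (Fin n) ℝ) (μ : Fin n → ℝ), K.transpose * firstForm f x * K = 1 ∧
      K.transpose * secondForm f x * K = Matrix.diagonal μ := by
  obtain ⟨K, hK⟩ := exists_firstForm_orthonormal f x
  have hβ : (secondForm f x).transpose = secondForm f x := by
    rw [secondForm, Matrix.transpose_smul, (isSymm_hess hf).eq]
  -- In an orthonormal basis for the first form, the second form is a symmetric matrix, and an
  -- orthogonal change of basis diagonalizes it without disturbing the first form.
  have hM : (K.transpose * secondForm f x * K).IsHermitian := by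
    rw [Matrix.IsHermitian, Matrix.conjTranspose_eq_transpose_of_trivial, Matrix.transpose_mul,
      Matrix.transpose_mul, Matrix.transpose_transpose, hβ, Matrix.mul_assoc]
  set U : Matrix (Fin n) (Fin n) ℝ := (hM.eigenvectorUnitary : Matrix (Fin n) (Fin n) ℝ) with hU
  have hUt : star U = U.transpose := Matrix.conjTranspose_eq_transpose_of_trivial U
  refine ⟨K * U, hM.eigenvalues, ?_, ?_⟩
  · calc (K * U).transpose * firstForm f x * (K * U)
        = U.transpose * (K.transpose * firstForm f x * K) * U := by
          simp only [Matrix.transpose_mul, Matrix.mul_assoc]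
      _ = 1 := by rw [hK, mul_one, ← hUt]; exact Unitary.coe_star_mul_self hM.eigenvectorUnitary
  · have h := hM.conjStarAlgAut_star_eigenvectorUnitary
    rw [Unitary.conjStarAlgAut_star_apply] at h
    calc (K * U).transpose * secondForm f x * (K * U)
        = star U * (K.transpose * secondForm f x * K) * U := by
          simp only [Matrix.transpose_mul, Matrix.mul_assoc, hUt]
      _ = _ := h

/-- The traces of the powers of the conformal shape operator are the power sums of the conformal
principal curvatures. -/
theorem trace_confShapeOp_pow {n : ℕ} {f : (Fin n → ℝ) → ℝ} {x : Fin n → ℝ}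
    {K : Matrix (Fin n) (Fin n) ℝ} {μ : Fin n → ℝ} (hK : K.transpose * firstForm f x * K = 1)
    (hμ : K.transpose * secondForm f x * K = Matrix.diagonal μ) (h : ℕ) :
    (confShapeOp f x ^ h).trace = ∑ i, (μ i - (∑ k, μ k) / n) ^ h := by
  set g := firstForm f x with hg
  have hgt : g.transpose = g := by
    rw [hg, firstForm, Matrix.transpose_add, Matrix.transpose_one, Matrix.transpose_vecMulVec]
  have h1 : K * (K.transpose * g) = 1 := mul_eq_one_comm.1 hK
  have hginv : g⁻¹ = K * K.transpose := Matrix.inv_eq_left_inv (by rw [Matrix.mul_assoc, h1])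
  -- Since `Kᵀ g` is the inverse of `K`, this is a conjugation, which commutes with powers and
  -- preserves traces.
  have hA : shapeOp f x = K * Matrix.diagonal μ * (K.transpose * g) := by
    rw [shapeOp, ← hg, hginv, ← hμ]
    calc K * K.transpose * secondForm f x
        = K * K.transpose * secondForm f x * (K * (K.transpose * g)) := by rw [h1, mul_one]
      _ = _ := by simp only [Matrix.mul_assoc]
  have htr : (shapeOp f x).trace = ∑ k, μ k := by
    rw [hA, Matrix.trace_mul_comm, ← Matrix.mul_assoc, hK, one_mul, Matrix.trace_diagonal]
  have hconf : confShapeOp f x =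
      K * Matrix.diagonal (fun i => μ i - (∑ k, μ k) / n) * (K.transpose * g) := by
    have hd : Matrix.diagonal (fun i => μ i - (∑ k, μ k) / n) =
        Matrix.diagonal μ - ((∑ k, μ k) / n) • (1 : Matrix (Fin n) (Fin n) ℝ) := by
      rw [Matrix.smul_one_eq_diagonal, Matrix.diagonal_sub]
    rw [confShapeOp, htr, hA, hd, Matrix.mul_sub, Matrix.sub_mul, Matrix.mul_smul, Matrix.smul_mul,
      mul_one, h1]
  have hpow : ∀ k : ℕ, confShapeOp f x ^ k =
      K * Matrix.diagonal (fun i => (μ i - (∑ k, μ k) / n) ^ k) * (K.transpose * g) := by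
    intro k
    induction k with
    | zero => simp [h1]
    | succ k ih =>
      rw [pow_succ, ih, hconf]
      calc K * Matrix.diagonal (fun i => (μ i - (∑ k, μ k) / n) ^ k) * (K.transpose * g) *
            (K * Matrix.diagonal (fun i => μ i - (∑ k, μ k) / n) * (K.transpose * g))
          = K * Matrix.diagonal (fun i => (μ i - (∑ k, μ k) / n) ^ k) * (K.transpose * g * K) *
            Matrix.diagonal (fun i => μ i - (∑ k, μ k) / n) * (K.transpose * g) := by
            simp only [Matrix.mul_assoc]
        _ = _ := by
            rw [hK, mul_one, Matrix.mul_assoc K, Matrix.diagonal_mul_diagonal]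
            simp only [pow_succ]
  rw [hpow, Matrix.trace_mul_comm, ← Matrix.mul_assoc, hK, one_mul, Matrix.trace_diagonal]

/-- Invariant equations are determined by the quadrics in normal form: the jet belongs to the equation
if and only if the conformal principal curvatures, in any order and up to a scale, satisfy it. -/
theorem jet_mem_iff_eval_eq_zero {n : ℕ} (hn : 1 ≤ n) {E : Set (J2 n)} (hE : IsInvariant E)
    {b₀ : Frame n} {Φ : ℝ → (Fin n → ℝ) → (Fin n → ℝ) → MvPolynomial (Fin n × Fin n) ℝ}
    (hΦ : ∀ (P : PointedHypersurface n) (f : (Fin n → ℝ) → ℝ) (x : Fin n → ℝ), P.IsGraph b₀ f x →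
      (jet P ∈ E ↔
        MvPolynomial.eval (fun ij => hess f x ij.1 ij.2) (Φ (f x) x (grad f x)) = 0))
    {P : PointedHypersurface n} {b : Frame n} {f : (Fin n → ℝ) → ℝ} {x : Fin n → ℝ}
    (hP : P.IsGraph b f x) {K : Matrix (Fin n) (Fin n) ℝ} {μ : Fin n → ℝ}
    (hK : K.transpose * firstForm f x * K = 1)
    (hμ : K.transpose * secondForm f x * K = Matrix.diagonal μ)
    {t : ℝ} (ht : t ≠ 0) (σ : Equiv.Perm (Fin n)) :
    jet P ∈ E ↔ MvPolynomial.eval (fun ij : Fin n × Fin n =>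
      Matrix.diagonal (fun i => t * (μ (σ i) - (∑ k, μ k) / n)) ij.1 ij.2) (Φ 0 0 0) = 0 := by
  set l : Fin n → ℝ := fun i => t * (μ (σ i) - (∑ k, μ k) / n) with hl
  have hsub : ∀ M : Matrix (Fin n) (Fin n) ℝ,
      (K.submatrix id σ).transpose * M * K.submatrix id σ = (K.transpose * M * K).submatrix σ σ :=
    fun M => by ext i j; simp [Matrix.mul_apply]
  -- Permuting the columns of `K` permutes the curvatures, `c` is minus their mean and so removes
  -- the trace, and `s = t⁻¹` cancels the factor `t` in `l`.
  obtain ⟨b', hb'⟩ := hP.exists_jet_eq (K := K.submatrix id σ) (c := -((∑ k, μ k) / n)) (s := t⁻¹)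
    (l := l) (inv_ne_zero ht) (by rw [hsub, hK, Matrix.submatrix_one_equiv]) (by
      rw [hsub, Matrix.mul_add, Matrix.add_mul, Matrix.mul_smul, Matrix.smul_mul, hK, hμ]
      ext i j
      by_cases hij : i = j
      · subst hij
        simp [hl, ht, sub_eq_add_neg]
      · simp [hij])
  have hjet := hasTwoJetAt_quadric l
  -- Moved to `b₀`, the quadric has zero value and gradient at the origin, so only the polynomial `Φ
  -- 0 0 0` is ever evaluated.
  rw [hb', jet_quadricHypersurface_mem_iff hn hE b' b₀,
    hΦ _ _ _ (isGraph_quadricHypersurface b₀ l), hjet.value, hjet.grad, hjet.hess]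

end ConfSphere
end

/-! ### Symmetrization of the defining polynomial and conclusion -/

open MvPolynomial in
theorem theorem5 (n : ℕ) (hn : 1 ≤ n) (E : Set (ConfSphere.J2 n))
    (hinv : ConfSphere.IsInvariant E) (hpoly : ConfSphere.IsPolynomial E) :
    ∃ (d : ℕ) (F : MvPolynomial (Finset.Icc 2 n) ℝ),
      F.IsWeightedHomogeneous (fun h : Finset.Icc 2 n => (h : ℕ)) d ∧
      ∀ (P : ConfSphere.PointedHypersurface n) (b : ConfSphere.Frame n)
        (f : (Fin n → ℝ) → ℝ) (x : Fin n → ℝ), P.IsGraph b f x →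
        (ConfSphere.jet P ∈ E ↔
          MvPolynomial.eval
            (fun h : Finset.Icc 2 n => (ConfSphere.confShapeOp f x ^ (h : ℕ)).trace) F = 0) := by
  obtain ⟨b₀, Φ, hΦ⟩ := hpoly
  let ψ : MvPolynomial (Fin n) ℝ :=
    aeval (fun ij : Fin n × Fin n => if ij.1 = ij.2 then X ij.1 else 0) (Φ 0 0 0)
  have hψ : ∀ l : Fin n → ℝ, eval l ψ =
      eval (fun ij : Fin n × Fin n => Matrix.diagonal l ij.1 ij.2) (Φ 0 0 0) := by
    intro l
    simp only [ψ, ← coe_aeval_eq_eval, RingHom.coe_coe]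
    rw [← AlgHom.comp_apply, comp_aeval]
    congr 2
    funext ij
    by_cases h : ij.1 = ij.2 <;> simp [h]
  -- A sum of squares, rather than a plain average, keeps the real zero set equal to the common
  -- zeros of the permuted `ψ`.
  let Q : MvPolynomial (Fin n) ℝ := ∑ σ : Equiv.Perm (Fin n), rename σ ψ ^ 2
  have hQ : Q.IsSymmetric := by
    intro e
    simp only [Q, map_sum, map_pow, rename_rename]
    exact Fintype.sum_equiv (Equiv.mulLeft e) _ _ fun σ => rfl
  have hQ0 : ∀ l : Fin n → ℝ, eval l Q = 0 ↔ ∀ σ : Equiv.Perm (Fin n), eval (l ∘ σ) ψ = 0 := by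
    intro l
    simp only [Q, map_sum, map_pow, eval_rename]
    rw [Finset.sum_eq_zero_iff_of_nonneg fun σ _ => sq_nonneg _]
    simp
  obtain ⟨G, hG⟩ := ConfSphere.exists_eval_powerSums hQ
  obtain ⟨d, F, hF, hFG⟩ := ConfSphere.exists_isWeightedHomogeneous_eval_powerSums hn G
  refine ⟨d, F, hF, fun P b f x hP => ?_⟩
  have hf : ContDiffAt ℝ 2 f x := by
    exact_mod_cast contDiffAt_infty.1 hP.2.1.self_of_nhds 2
  obtain ⟨K, μ, hK, hμ⟩ := ConfSphere.exists_principal_basis hf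
  simp only [ConfSphere.trace_confShapeOp_pow hK hμ]
  rw [← hFG]
  have hn0 : (n : ℝ) ≠ 0 := by positivity
  have hsum : ∀ t : ℝ, ∑ i, t * (μ i - (∑ k, μ k) / n) = 0 := by
    intro t
    rw [← Finset.mul_sum, Finset.sum_sub_distrib]
    simp [mul_div_cancel₀ _ hn0]
  -- The left side involves neither `t` nor `σ`: vanishing of `ψ` for one choice is equivalent to
  -- vanishing for all, hence to vanishing of `G` along the whole ray.
  have hmem : ∀ (t : ℝ), 0 < t → ∀ σ : Equiv.Perm (Fin n), (ConfSphere.jet P ∈ E ↔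
      eval ((fun i => t * (μ i - (∑ k, μ k) / n)) ∘ σ) ψ = 0) := by
    intro t ht σ
    rw [hψ, ConfSphere.jet_mem_iff_eval_eq_zero hn hinv hΦ hP hK hμ ht.ne' σ]
    rfl
  constructor
  · intro h t ht
    rw [← hG _ (hsum t), hQ0]
    exact fun σ => (hmem t ht σ).1 h
  · intro h
    have h1 := h 1 one_pos
    rw [← hG _ (hsum 1), hQ0] at h1
    exact (hmem 1 one_pos 1).2 (h1 1)
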